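/- Let $E$ and $F$ be real Banach lattices with $F$ Dedekind complete, let $m \ge 0$, and let $P \colon E \to F$ be a regular $m$-homogeneous polynomial. Here an $m$-homogeneous polynomial is a map $P(x) = A(x,\dots,x)$ generated by a (unique) symmetric $m$-linear mapping $A \colon E^m \to F$; it is positive if $A(x_1,\dots,x_m) \ge 0$ for all $x_1,\dots,x_m \ge 0$, and regular if it is a difference of two positive $m$-homogeneous polynomials. Regular polynomials are ordered by $P \le Q$ if and only if $Q-P$ is positive. The complexification $E_{\mathbb C} = \{x+iy : x,y\in E\}$ carries the modulus $|x+iy| = \sup_{\theta}(x\cos\theta + y\sin\theta) \in E$ and the norm $\|z\| = \|\,|z|\,\|$, and similarly for $F_{\mathbb C}$. The complexification $P_{\mathbb C} \colon E_{\mathbb C}\to F_{\mathbb C}$ is the complex $m$-homogeneous polynomial generated by the complex $m$-linear extension $A_{\mathbb C}$ of $A$. A complex $m$-homogeneous polynomial $Q \colon E_{\mathbb C}\to F_{\mathbb C}$ is written uniquely as $Q = (P_0)_{\mathbb C} + i (P_1)_{\mathbb C}$ with real $m$-homogeneous polynomials $P_0,P_1 \colon E\to F$ given by $P_0(x) = \operatorname{Re}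 Q(x)$, $P_1(x) = \operatorname{Im} Q(x)$ for $x \in E$; it is regular if $P_0$ and $P_1$ are, and its modulus is then $|Q| = \sup_\theta (P_0\cos\theta + P_1\sin\theta)$, the supremum being taken in the ordered space of regular $m$-homogeneous polynomials from $E$ to $F$; $|Q|$ is considered as a polynomial on $E_{\mathbb C}$ by complexification. The modulus of a real regular polynomial is $|P| = P \vee (-P)$ in the same ordered space. The regular norms are $$\|P\|_r = \sup\{\| |P|(x)\| : x\in E,\ \|x\|\le 1\}, \qquad \|Q\|_r = \sup\{\| |Q|(z)\| : z\in E_{\mathbb C},\ \|z\|\le 1\}.$$ Then $P_{\mathbb C}$ is regular, the moduli $|P|$ and $|P_{\mathbb C}|$ exist, the suprema that define $\|P\|_r$ and $\|P_{\mathbb C}\|_r$ are finite, $|P_{\mathbb C}| = |P|_{\mathbb C}$, and $$\|P_{\mathbb C}\|_r = \|P\|_r .$$ -/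

import Mathlib

open Filter Topology

set_option linter.unusedSectionVars false

noncomputable section

/-- Every nonempty subset that is bounded above has a supremum. -/
def DedekindComplete (F : Type*) [Preorder F] : Prop :=
  ∀ S : Set F, S.Nonempty → BddAbove S → ∃ a, IsLUB S a

/-! ### The complexification of a real vector space -/

/-- The complexification of a real vector space `E`: the elements are `z = x + i y`. -/
@[ext]
structure Complexification (E : Type*) where
  re : E
  im : E

namespace Complexification

section Algebra

variable {E : Type*} [AddCommGroup E]

instance : Zero (Complexification E) := ⟨⟨0, 0⟩⟩
instance : Add (Complexification E) := ⟨fun z w => ⟨z.re + w.re, z.im + w.im⟩⟩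
instance : Neg (Complexification E) := ⟨fun z => ⟨-z.re, -z.im⟩⟩
instance : Sub (Complexification E) := ⟨fun z w => ⟨z.re - w.re, z.im - w.im⟩⟩

@[simp] theorem zero_re : (0 : Complexification E).re = 0 := rfl
@[simp] theorem zero_im : (0 : Complexification E).im = 0 := rfl
@[simp] theorem add_re (z w : Complexification E) : (z + w).re = z.re + w.re := rfl
@[simp] theorem add_im (z w : Complexification E) : (z + w).im = z.im + w.im := rfl
@[simp] theorem neg_re (z : Complexification E) : (-z).re = -z.re := rfl
@[simp] theorem neg_im (z : Complexification E) : (-z).im = -z.im := rfl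
@[simp] theorem sub_re (z w : Complexification E) : (z - w).re = z.re - w.re := rfl
@[simp] theorem sub_im (z w : Complexification E) : (z - w).im = z.im - w.im := rfl

instance : AddCommGroup (Complexification E) where
  add_assoc a b c := by ext <;> simp [add_assoc]
  zero_add a := by ext <;> simp
  add_zero a := by ext <;> simp
  add_comm a b := by ext <;> simp [add_comm]
  neg_add_cancel a := by ext <;> simp
  sub_eq_add_neg a b := by ext <;> simp [sub_eq_add_neg]
  nsmul := nsmulRec
  zsmul := zsmulRec

variable [Module ℝ E]

/-- `(a + i b) (x + i y) = (a x - b y) + i (a y + b x)`. -/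
instance : SMul ℂ (Complexification E) :=
  ⟨fun c z => ⟨c.re • z.re - c.im • z.im, c.re • z.im + c.im • z.re⟩⟩

@[simp] theorem smul_re (c : ℂ) (z : Complexification E) :
    (c • z).re = c.re • z.re - c.im • z.im := rfl
@[simp] theorem smul_im (c : ℂ) (z : Complexification E) :
    (c • z).im = c.re • z.im + c.im • z.re := rfl

instance : Module ℂ (Complexification E) where
  one_smul z := by ext <;> simp
  mul_smul a b z := by ext <;> simp <;> module
  smul_zero a := by ext <;> simp
  smul_add a z w := by ext <;> simp <;> module
  add_smul a b z := by ext <;> simp <;> module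
  zero_smul z := by ext <;> simp

/-- The embedding `x ↦ x + i 0` of `E` into its complexification. -/
def ofReal (x : E) : Complexification E := ⟨x, 0⟩

theorem ofReal_add (x y : E) : ofReal (x + y) = ofReal x + ofReal y := by
  ext <;> simp [ofReal]

theorem ofReal_smul (c : ℝ) (x : E) : ofReal (c • x) = (c : ℂ) • ofReal x := by
  ext
  · rw [smul_re]; simp [ofReal]
  · rw [smul_im]; simp [ofReal]

/-- The complexification `x + i y ↦ T x + i T y` of a real linear mapping. -/
def mapLinear {F : Type*} [AddCommGroup F] [Module ℝ F] (T : E →ₗ[ℝ] F) :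
    Complexification E →ₗ[ℂ] Complexification F where
  toFun z := ⟨T z.re, T z.im⟩
  map_add' z w := by ext <;> simp
  map_smul' c z := by ext <;> simp

end Algebra

/-! ### The modulus and the norm on the complexification of a Banach lattice -/

section Lattice

variable {E : Type*} [NormedAddCommGroup E] [Lattice E] [HasSolidNorm E] [IsOrderedAddMonoid E]
  [NormedSpace ℝ E] [IsOrderedModule ℝ E]

theorem rotation_le (x y : E) (s t : ℝ) :
    Real.cos s • x + Real.sin s • y
      ≤ Real.cos t • x + Real.sin t • y + |s - t| • (|x| + |y|) := by
  have key : ∀ (c d : ℝ) (v : E), |c - d| ≤ |s - t| → c • v ≤ d • v + |s - t| • |v| := by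
    intro c d v h
    have h1 : (c - d) • v ≤ |s - t| • |v| :=
      calc (c - d) • v ≤ |c - d| • |v| := by
            rcases le_total 0 (c - d) with h0 | h0
            · rw [abs_of_nonneg h0]
              exact smul_le_smul_of_nonneg_left (le_abs_self v) h0
            · rw [abs_of_nonpos h0, ← neg_smul_neg]
              exact smul_le_smul_of_nonneg_left (neg_le_abs v) (neg_nonneg.2 h0)
        _ ≤ |s - t| • |v| := smul_le_smul_of_nonneg_right h (abs_nonneg v)
    rw [sub_smul] at h1
    exact sub_le_iff_le_add'.1 h1
  have hc := key _ _ x (Real.abs_cos_sub_cos_le s t)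
  have hs := key _ _ y (Real.abs_sin_sub_sin_le s t)
  calc _ ≤ _ := add_le_add hc hs
    _ = _ := by rw [smul_add]; abel

theorem exists_approx (x y : E) (n : ℕ) :
    ∃ a : E, (∀ t : ℝ, Real.cos t • x + Real.sin t • y
        ≤ a + (1 / ((n : ℝ) + 1)) • (|x| + |y|)) ∧
      ∀ b ∈ upperBounds (Set.range fun t : ℝ => Real.cos t • x + Real.sin t • y), a ≤ b := by
  set f : ℝ → E := fun t => Real.cos t • x + Real.sin t • y with hf
  have hN : (0 : ℝ) < (n : ℝ) + 1 := by positivity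
  refine ⟨(Finset.range (7 * (n + 1) + 1)).sup' ⟨0, by simp⟩ (fun k => f (k / ((n : ℝ) + 1))),
    fun t => ?_, fun b hb => Finset.sup'_le _ _ fun k _ => hb ⟨_, rfl⟩⟩
  have hper : Function.Periodic f (2 * Real.pi) := fun t => by
    simp [hf, Real.cos_add_two_pi, Real.sin_add_two_pi]
  obtain ⟨s, ⟨hs0, hs1⟩, hst⟩ := hper.exists_mem_Ico₀ Real.two_pi_pos t
  change f t ≤ _
  rw [hst]
  have hk := Nat.floor_le (mul_nonneg hs0 hN.le)
  have hk' := Nat.lt_floor_add_one (s * ((n : ℝ) + 1))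
  set k := ⌊s * ((n : ℝ) + 1)⌋₊
  have hkr : k ∈ Finset.range (7 * (n + 1) + 1) := by
    have : (k : ℝ) < 7 * (n + 1) := by
      have := Real.pi_lt_d2
      nlinarith
    have : k < 7 * (n + 1) := by exact_mod_cast this
    rw [Finset.mem_range]; omega
  have hd : |s - k / ((n : ℝ) + 1)| ≤ 1 / ((n : ℝ) + 1) := by
    have : s - k / ((n : ℝ) + 1) = (s * ((n : ℝ) + 1) - k) / ((n : ℝ) + 1) := by
      field_simp
    rw [this, abs_div, abs_of_pos hN]
    gcongr
    rw [abs_le]; constructor <;> linarith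
  refine (rotation_le x y s (k / ((n : ℝ) + 1))).trans (add_le_add ?_ ?_)
  · exact Finset.le_sup' (fun k : ℕ => f (k / ((n : ℝ) + 1))) hkr
  · exact smul_le_smul_of_nonneg_right hd (by positivity)

/-- In a real Banach lattice the supremum defining the modulus exists. -/
theorem exists_isLUB_rotations [CompleteSpace E] (x y : E) :
    ∃ r, IsLUB (Set.range fun t : ℝ => Real.cos t • x + Real.sin t • y) r := by
  choose a ha hb using exists_approx x y
  set e := |x| + |y| with he
  have he0 : 0 ≤ e := by positivity
  have hδ : Tendsto (fun n : ℕ => 1 / ((n : ℝ) + 1)) atTop (𝓝 0) :=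
    tendsto_one_div_add_atTop_nhds_zero_nat
  have hle : ∀ n m, a n ≤ a m + (1 / ((m : ℝ) + 1)) • e := fun n m =>
    hb n _ (by rintro _ ⟨t, rfl⟩; exact ha m t)
  have hcau : CauchySeq a := by
    have hb0 : Tendsto (fun n : ℕ => 1 / ((n : ℝ) + 1) * ‖e‖) atTop (𝓝 0) := by
      simpa using hδ.mul_const ‖e‖
    refine cauchySeq_of_le_tendsto_0 _ (fun n m N hn hm => ?_) hb0
    have hNn : 1 / ((n : ℝ) + 1) ≤ 1 / ((N : ℝ) + 1) := by gcongr
    have hNm : 1 / ((m : ℝ) + 1) ≤ 1 / ((N : ℝ) + 1) := by gcongr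
    have h1 : |a n - a m| ≤ |(1 / ((N : ℝ) + 1)) • e| := by
      rw [abs_of_nonneg (smul_nonneg (by positivity) he0)]
      refine abs_le'.2 ⟨?_, ?_⟩
      · rw [sub_le_iff_le_add']
        exact (hle n m).trans (by gcongr)
      · rw [neg_sub, sub_le_iff_le_add']
        exact (hle m n).trans (by gcongr)
    rw [dist_eq_norm]
    refine (norm_le_norm_of_abs_le_abs h1).trans_eq ?_
    rw [norm_smul, Real.norm_of_nonneg (by positivity)]
  obtain ⟨r, hr⟩ := cauchySeq_tendsto_of_complete hcau
  refine ⟨r, ?_, fun b hbb => le_of_tendsto' hr fun n => hb n b hbb⟩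
  rintro _ ⟨t, rfl⟩
  have : Tendsto (fun n : ℕ => a n + (1 / ((n : ℝ) + 1)) • e) atTop (𝓝 r) := by
    simpa using hr.add (hδ.smul_const e)
  exact ge_of_tendsto' this fun n => ha n t

variable [CompleteSpace E]

/-- The modulus `|x + i y| = sup {x cos θ + y sin θ}` (by periodicity the supremum over all real
`θ` is the supremum over `[0, 2π]`). -/
def modulus (z : Complexification E) : E :=
  Classical.choose (exists_isLUB_rotations z.re z.im)

theorem isLUB_modulus (z : Complexification E) :
    IsLUB (Set.range fun t : ℝ => Real.cos t • z.re + Real.sin t • z.im) z.modulus :=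
  Classical.choose_spec (exists_isLUB_rotations z.re z.im)

/-- The norm of the complex Banach lattice: `‖z‖ = ‖ |z| ‖`. -/
instance : Norm (Complexification E) := ⟨fun z => ‖z.modulus‖⟩

theorem norm_def (z : Complexification E) : ‖z‖ = ‖z.modulus‖ := rfl

end Lattice

end Complexification

/-! ### Homogeneous polynomials -/

section Polynomials

variable {𝕜 : Type*} [Field 𝕜] [CharZero 𝕜] {m : ℕ} {E F : Type*}
  [AddCommGroup E] [Module 𝕜 E] [AddCommGroup F] [Module 𝕜 F]

/-- `P = Â`: the `m`-linear mapping `A` is symmetric and `P x = A (x, …, x)` for all `x`. -/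
def IsGeneratedBy (P : E → F) (A : MultilinearMap 𝕜 (fun _ : Fin m => E) F) : Prop :=
  (∀ (σ : Equiv.Perm (Fin m)) (x : Fin m → E), A (fun i => x (σ i)) = A x) ∧
    ∀ x, P x = A (fun _ => x)

variable (𝕜 m E F) in
/-- The space of `m`-homogeneous polynomials from `E` to `F`, as a subspace of the space of all
functions from `E` to `F`. -/
def homPolySubmodule : Submodule 𝕜 (E → F) where
  carrier := {P | ∃ A : MultilinearMap 𝕜 (fun _ : Fin m => E) F, IsGeneratedBy P A}
  zero_mem' := ⟨0, fun _ _ => rfl, fun _ => rfl⟩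
  add_mem' := by
    rintro P Q ⟨A, hA, hP⟩ ⟨B, hB, hQ⟩
    exact ⟨A + B, fun σ x => by simp [hA σ x, hB σ x], fun x => by simp [hP x, hQ x]⟩
  smul_mem' := by
    rintro c P ⟨A, hA, hP⟩
    exact ⟨c • A, fun σ x => by simp [hA σ x], fun x => by simp [hP x]⟩

variable (𝕜 m E F) in
/-- The `m`-homogeneous polynomials from `E` to `F`, with the pointwise operations. -/
abbrev HomPoly : Type _ := homPolySubmodule 𝕜 m E F

instance : CoeFun (HomPoly 𝕜 m E F) (fun _ => E → F) := ⟨Subtype.val⟩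

/-- The symmetric `m`-linear mapping that generates a homogeneous polynomial. -/
def HomPoly.polar (P : HomPoly 𝕜 m E F) : MultilinearMap 𝕜 (fun _ : Fin m => E) F :=
  Classical.choose P.2

theorem HomPoly.isGeneratedBy_polar (P : HomPoly 𝕜 m E F) :
    IsGeneratedBy P P.polar :=
  Classical.choose_spec P.2

end Polynomials

/-! ### Complexification of multilinear mappings and polynomials -/

section Complexify

variable {m : ℕ} {E F : Type*} [AddCommGroup E] [Module ℝ E] [AddCommGroup F] [Module ℝ F]

/-- The argument `(x₁^{δ₁}, …, x_m^{δ_m})`, where `δ` is the indicator function of `s` and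
`z_j = x_j⁰ + i x_j¹`. -/
def selectParts (s : Finset (Fin m)) (z : Fin m → Complexification E) : Fin m → E :=
  fun j => if j ∈ s then (z j).im else (z j).re

/-- The complexification
`A_ℂ (z₁, …, z_m) = ∑_δ i^{∑ δ_j} A (x₁^{δ₁}, …, x_m^{δ_m})` of a real `m`-linear mapping,
as a function. The sum is over all `δ ∈ {0, 1}^m`, given as subsets of `{1, …, m}`. -/
def complexifyFun (A : MultilinearMap ℝ (fun _ : Fin m => E) F)
    (z : Fin m → Complexification E) : Complexification F :=
  ∑ s : Finset (Fin m), (Complex.I ^ s.card) • Complexification.ofReal (A (selectParts s z))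

theorem selectParts_update (s : Finset (Fin m)) (z : Fin m → Complexification E)
    (j : Fin m) (w : Complexification E) :
    selectParts s (Function.update z j w)
      = Function.update (selectParts s z) j (if j ∈ s then w.im else w.re) := by
  funext k
  by_cases h : k = j
  · subst h; simp [selectParts]
  · simp [selectParts, h]

theorem complexifyFun_update (A : MultilinearMap ℝ (fun _ : Fin m => E) F)
    (z : Fin m → Complexification E) (j : Fin m) (w : Complexification E) :
    complexifyFun A (Function.update z j w) =
      ∑ s ∈ (Finset.univ.erase j).powerset, (Complex.I ^ s.card) •
        Complexification.mapLinear (A.toLinearMap (selectParts s z) j) w := by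
  have huniv : (Finset.univ : Finset (Finset (Fin m)))
      = (insert j (Finset.univ.erase j)).powerset := by
    rw [Finset.insert_erase (Finset.mem_univ j), Finset.powerset_univ]
  unfold complexifyFun
  rw [huniv, Finset.sum_powerset_insert (Finset.notMem_erase j _), ← Finset.sum_add_distrib]
  refine Finset.sum_congr rfl fun s hs => ?_
  have hj : j ∉ s := fun h => by simpa using Finset.mem_powerset.1 hs h
  have hupd : Function.update (selectParts (insert j s) z) j w.im
      = Function.update (selectParts s z) j w.im := by
    funext k
    by_cases h : k = j
    · subst h; simp
    · simp [selectParts, h]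
  rw [Finset.card_insert_of_notMem hj, selectParts_update, selectParts_update, pow_succ, mul_smul,
    ← smul_add]
  congr 1
  simp only [hj, Finset.mem_insert, true_or, if_true, if_false, hupd]
  ext <;> simp [Complexification.ofReal, Complexification.mapLinear]

/-- The complexification `A_ℂ` of a real `m`-linear mapping `A`. -/
def MultilinearMap.complexify (A : MultilinearMap ℝ (fun _ : Fin m => E) F) :
    MultilinearMap ℂ (fun _ : Fin m => Complexification E) (Complexification F) :=
  MultilinearMap.mk' (complexifyFun A)
    (fun z j x y => by simp only [complexifyFun_update, map_add, smul_add, Finset.sum_add_distrib])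
    (fun z j c x => by
      simp only [complexifyFun_update, map_smul, Finset.smul_sum]
      exact Finset.sum_congr rfl fun s _ => smul_comm _ _ _)

theorem MultilinearMap.complexify_apply (A : MultilinearMap ℝ (fun _ : Fin m => E) F)
    (z : Fin m → Complexification E) :
    A.complexify z =
      ∑ s : Finset (Fin m), (Complex.I ^ s.card) • Complexification.ofReal (A (selectParts s z)) :=
  rfl

theorem complexify_symm (A : MultilinearMap ℝ (fun _ : Fin m => E) F)
    (hA : ∀ (σ : Equiv.Perm (Fin m)) (x : Fin m → E), A (fun i => x (σ i)) = A x)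
    (σ : Equiv.Perm (Fin m)) (z : Fin m → Complexification E) :
    A.complexify (fun i => z (σ i)) = A.complexify z := by
  simp only [MultilinearMap.complexify_apply]
  refine Fintype.sum_equiv (Equiv.finsetCongr σ) _ _ fun s => ?_
  have h : selectParts s (fun i => z (σ i))
      = fun i => selectParts (s.map σ.toEmbedding) z (σ i) := by
    funext i; simp [selectParts]
  rw [h, hA]
  simp

namespace HomPoly

/-- The complexification `P_ℂ` of a real `m`-homogeneous polynomial `P`: if `P = Â`, then `P_ℂ`
is the complex `m`-homogeneous polynomial generated by `A_ℂ`. -/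
def complexify (P : HomPoly ℝ m E F) :
    HomPoly ℂ m (Complexification E) (Complexification F) :=
  ⟨fun z => P.polar.complexify (fun _ => z),
    P.polar.complexify, complexify_symm _ P.isGeneratedBy_polar.1, fun _ => rfl⟩

/-- The complexification of `P` extends `P`. -/
theorem complexify_ofReal (P : HomPoly ℝ m E F) (x : E) :
    P.complexify (Complexification.ofReal x)
      = Complexification.ofReal (P x) := by
  change P.polar.complexify (fun _ => Complexification.ofReal x) = _
  rw [MultilinearMap.complexify_apply, Finset.sum_eq_single ∅]
  · rw [P.isGeneratedBy_polar.2 x]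
    simp only [Finset.card_empty, pow_zero, one_smul]
    rfl
  · intro s _ hs
    obtain ⟨j, hj⟩ := Finset.nonempty_iff_ne_empty.2 hs
    rw [P.polar.map_coord_zero j (by simp [selectParts, hj, Complexification.ofReal])]
    ext <;> simp [Complexification.ofReal]
  · simp

/-- The real polynomial `P₀` in the decomposition `Q = P₀ + i P₁` of a complex polynomial `Q`:
`P₀ x = re (Q x)` for real arguments `x`. -/
def rePart (Q : HomPoly ℂ m (Complexification E) (Complexification F)) : HomPoly ℝ m E F :=
  ⟨fun x => (Q (Complexification.ofReal x)).re, by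
    obtain ⟨A, hA, hQ⟩ := Q.2
    refine ⟨MultilinearMap.mk' (fun x => (A fun i => Complexification.ofReal (x i)).re)
      (fun x i u v => ?_) (fun x i c u => ?_),
      fun σ x => congrArg Complexification.re (hA σ fun i => Complexification.ofReal (x i)),
      fun x => congrArg Complexification.re (hQ _)⟩
    · simp only [Function.apply_update (fun _ => Complexification.ofReal)]
      rw [Complexification.ofReal_add, A.map_update_add]
      simp
    · simp only [Function.apply_update (fun _ => Complexification.ofReal)]
      rw [Complexification.ofReal_smul, A.map_update_smul, Complexification.smul_re]
      simp⟩

/-- The real polynomial `P₁` in the decomposition `Q = P₀ + i P₁` of a complex polynomial `Q`: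
`P₁ x = im (Q x)` for real arguments `x`. -/
def imPart (Q : HomPoly ℂ m (Complexification E) (Complexification F)) : HomPoly ℝ m E F :=
  ⟨fun x => (Q (Complexification.ofReal x)).im, by
    obtain ⟨A, hA, hQ⟩ := Q.2
    refine ⟨MultilinearMap.mk' (fun x => (A fun i => Complexification.ofReal (x i)).im)
      (fun x i u v => ?_) (fun x i c u => ?_),
      fun σ x => congrArg Complexification.im (hA σ fun i => Complexification.ofReal (x i)),
      fun x => congrArg Complexification.im (hQ _)⟩
    · simp only [Function.apply_update (fun _ => Complexification.ofReal)]
      rw [Complexification.ofReal_add, A.map_update_add]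
      simp
    · simp only [Function.apply_update (fun _ => Complexification.ofReal)]
      rw [Complexification.ofReal_smul, A.map_update_smul, Complexification.smul_im]
      simp⟩

end HomPoly

end Complexify

/-! ### Positivity, regularity, moduli and regular norms -/

/-- The supremum norm `sup {‖f x‖ : ‖x‖ ≤ 1}`; it is meaningful if `BoundedOnUnitBall f`. -/
def supNorm {X Y : Type*} [Norm X] [Norm Y] (f : X → Y) : ℝ :=
  sSup ((fun x => ‖f x‖) '' {x | ‖x‖ ≤ 1})

/-- The mapping `f` is bounded on the closed unit ball, that is, `sup {‖f x‖ : ‖x‖ ≤ 1} < ∞`. -/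
def BoundedOnUnitBall {X Y : Type*} [Norm X] [Norm Y] (f : X → Y) : Prop :=
  BddAbove ((fun x => ‖f x‖) '' {x | ‖x‖ ≤ 1})

namespace HomPoly

section Order

variable {m : ℕ} {E F : Type*}
  [AddCommGroup E] [Lattice E] [Module ℝ E] [AddCommGroup F] [Lattice F] [Module ℝ F]

/-- A real polynomial `P = Â` is positive if `A (x₁, …, x_m) ≥ 0` for all `x₁, …, x_m ≥ 0`. -/
def IsPositive (P : HomPoly ℝ m E F) : Prop :=
  ∃ A : MultilinearMap ℝ (fun _ : Fin m => E) F, IsGeneratedBy P A ∧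
    ∀ x : Fin m → E, (∀ i, 0 ≤ x i) → 0 ≤ A x

/-- A real polynomial is regular if it is the difference of two positive polynomials. -/
def IsRegular (P : HomPoly ℝ m E F) : Prop :=
  ∃ P₁ P₂ : HomPoly ℝ m E F, P₁.IsPositive ∧ P₂.IsPositive ∧ P = P₁ - P₂

/-- `R` is the supremum of the set `S` in the space of regular polynomials, which is ordered by:
`P ≤ Q` if and only if `Q - P` is positive. -/
def IsRegularSup (S : Set (HomPoly ℝ m E F)) (R : HomPoly ℝ m E F) : Prop :=
  R.IsRegular ∧ (∀ P ∈ S, (R - P).IsPositive) ∧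
    ∀ Q : HomPoly ℝ m E F, Q.IsRegular → (∀ P ∈ S, (Q - P).IsPositive) → (Q - R).IsPositive

/-- `R` is the modulus `|P| = P ∨ (-P)`. -/
def IsModulus (P R : HomPoly ℝ m E F) : Prop :=
  IsRegularSup {P, -P} R

open Classical in
/-- The modulus `|P|` of a regular real polynomial (`0` if there is none). -/
def modulus (P : HomPoly ℝ m E F) : HomPoly ℝ m E F :=
  if h : ∃ R, P.IsModulus R then Classical.choose h else 0

/-- A complex polynomial is regular if its real and imaginary parts are. -/
def IsRegularC (Q : HomPoly ℂ m (Complexification E) (Complexification F)) : Prop :=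
  Q.rePart.IsRegular ∧ Q.imPart.IsRegular

/-- `R` is the modulus of the complex polynomial `Q = P₀ + i P₁` in the complexification of the
space of regular real polynomials, that is, `R = sup {P₀ cos θ + P₁ sin θ}`. -/
def IsModulusC (Q : HomPoly ℂ m (Complexification E) (Complexification F))
    (R : HomPoly ℝ m E F) : Prop :=
  IsRegularSup (Set.range fun t : ℝ => Real.cos t • Q.rePart + Real.sin t • Q.imPart) R

open Classical in
/-- The modulus `|Q|` of a regular complex polynomial, as a real polynomial `E → F` (`0` if there
is none). -/
def modulusC (Q : HomPoly ℂ m (Complexification E) (Complexification F)) : HomPoly ℝ m E F :=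
  if h : ∃ R, Q.IsModulusC R then Classical.choose h else 0

end Order

section RegularNorm

variable {m : ℕ} {E F : Type*}
  [NormedAddCommGroup E] [Lattice E] [HasSolidNorm E] [IsOrderedAddMonoid E]
  [NormedSpace ℝ E] [IsOrderedModule ℝ E] [CompleteSpace E]
  [NormedAddCommGroup F] [Lattice F] [HasSolidNorm F] [IsOrderedAddMonoid F]
  [NormedSpace ℝ F] [IsOrderedModule ℝ F] [CompleteSpace F]

/-- The regular norm `‖P‖_r = ‖ |P| ‖` of a real polynomial: the supremum norm of `|P|` over the
unit ball of `E`. -/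
def regularNorm (P : HomPoly ℝ m E F) : ℝ :=
  supNorm (P.modulus : E → F)

/-- The regular norm `‖Q‖_r = ‖ |Q| ‖` of a complex polynomial: the supremum norm of `|Q|`, viewed
as a polynomial on the complexification, over the unit ball of the complexification of `E`. -/
def regularNormC (Q : HomPoly ℂ m (Complexification E) (Complexification F)) : ℝ :=
  supNorm (Q.modulusC.complexify : Complexification E → Complexification F)

end RegularNorm

end HomPoly

end

/-! On real points `P_ℂ` has real part `P` and imaginary part zero, so the rotations defining
`|P_ℂ|` are the polynomials `cos θ • P`. Each is a convex combination of `P` and `-P`, both of which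
occur among them, so they have the same upper bounds as `{P, -P}`. Suprema are unique because
generators are unique (polarization) and the cone generates `E`; hence `|P_ℂ| = |P|` once `|P|`
exists. Existence is a Riesz–Kantorovich argument (`exists_multilinear_modulus`): on the cone the
modulus of `A` is the supremum of sums of `± A` over subdivisions of the arguments, and Riesz
decomposition makes this supremum additive in each variable.

For the norms, let `R = |P|`, a positive polynomial. Real points give `‖R‖ ≤ ‖R_ℂ‖`; the converse
follows from `|R_ℂ z| ≤ R |z|` (`MultilinearMap.modulus_complexify_le`). To obtain it, write `z` as
a finite sum of `exp (i θ) w` with `w ≥ 0` and `∑ w ≤ C • |z|`, expand `A_ℂ (z, …, z)`, replace the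
unimodular coefficients by one, and let `C` tend to one. Such decompositions come from folding
(`SectorDecomposable.double`): `|y|` replaces `y`, halving the sector, until two directions span a
narrow one. Finiteness of the norms is automatic continuity of positive polynomials. -/

/-! ### Polarization -/

section Polarization

variable {𝕜 : Type*} [Field 𝕜] [CharZero 𝕜] {m : ℕ} {E F : Type*}
  [AddCommGroup E] [Module 𝕜 E] [AddCommGroup F] [Module 𝕜 F]

/-- A symmetric multilinear mapping that vanishes on the diagonal is zero. -/
theorem MultilinearMap.eq_zero_of_symm_of_diag (A : MultilinearMap 𝕜 (fun _ : Fin m => E) F)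
    (hA : ∀ (σ : Equiv.Perm (Fin m)) (x : Fin m → E), A (fun i => x (σ i)) = A x)
    (h0 : ∀ x, A (fun _ => x) = 0) : A = 0 := by
  classical
  ext x
  let y : Finset (Fin m) → Fin m → E := fun s i => if i ∈ s then x i else 0
  let f : Finset (Fin m) → (Fin m → Fin m) → F :=
    fun s κ => (-1 : 𝕜) ^ s.card • A fun j => y s (κ j)
  -- The double sum is evaluated in two ways. For fixed `s`, summing over `κ` reassembles a diagonal
  -- value of `A`.
  have hsum : ∑ κ : Fin m → Fin m, ∑ s : Finset (Fin m), f s κ = 0 := by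
    rw [Finset.sum_comm]
    refine Finset.sum_eq_zero fun s _ => ?_
    rw [← Finset.smul_sum, ← A.map_sum (fun _ i => y s i), h0, smul_zero]
  have hbij : ∀ σ : Equiv.Perm (Fin m),
      ∑ s : Finset (Fin m), f s σ = (-1 : 𝕜) ^ m • A x := by
    intro σ
    rw [Finset.sum_eq_single Finset.univ]
    · simp only [f, y, Finset.mem_univ, if_true, Finset.card_univ, Fintype.card_fin, hA]
    · intro s _ hs
      obtain ⟨i, hi⟩ : ∃ i, i ∉ s := by
        by_contra! h
        exact hs (Finset.eq_univ_iff_forall.2 h)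
      simp only [f]
      rw [A.map_coord_zero (σ.symm i) (by simp [y, hi]), smul_zero]
    · simp
  -- An index `i` missed by `κ` makes the terms of `s` and `insert i s` cancel. Only permutations
  -- remain, each contributing the same value, so the total is `m! (-1) ^ m • A x`.
  have hnot : ∀ κ : Fin m → Fin m, ¬ Function.Bijective κ →
      ∑ s : Finset (Fin m), f s κ = 0 := by
    intro κ hκ
    obtain ⟨i, hi⟩ : ∃ i, ∀ j, κ j ≠ i := by
      by_contra! h
      exact hκ (Finite.surjective_iff_bijective.1 h)
    have huniv : (Finset.univ : Finset (Finset (Fin m)))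
        = (insert i (Finset.univ.erase i)).powerset := by
      rw [Finset.insert_erase (Finset.mem_univ i), Finset.powerset_univ]
    rw [huniv, Finset.sum_powerset_insert (Finset.notMem_erase i _), ← Finset.sum_add_distrib]
    refine Finset.sum_eq_zero fun s hs => ?_
    have his : i ∉ s := fun h => by simpa using Finset.mem_powerset.1 hs h
    have hy : (fun j => y (insert i s) (κ j)) = fun j => y s (κ j) := by
      funext j
      simp [y, hi j]
    simp only [f]
    rw [hy, Finset.card_insert_of_notMem his, pow_succ]
    module
  have hperm : ∑ κ : Fin m → Fin m, ∑ s : Finset (Fin m), f s κ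
      = ∑ _σ : Equiv.Perm (Fin m), (-1 : 𝕜) ^ m • A x := by
    symm
    refine Finset.sum_of_injOn (fun σ => (σ : Fin m → Fin m))
      (fun σ _ τ _ h => DFunLike.coe_injective h) (by simp) (fun κ _ hκ => hnot κ fun hb => ?_)
      (fun σ _ => (hbij σ).symm)
    exact hκ ⟨Equiv.ofBijective κ hb, by simp, rfl⟩
  rw [hsum, Finset.sum_const, Finset.card_univ, Fintype.card_perm, Fintype.card_fin,
    ← Nat.cast_smul_eq_nsmul 𝕜, smul_smul] at hperm
  have hne : ((m.factorial : 𝕜) * (-1) ^ m) ≠ 0 :=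
    mul_ne_zero (Nat.cast_ne_zero.2 m.factorial_ne_zero) (pow_ne_zero _ (by simp))
  exact (smul_eq_zero.1 hperm.symm).resolve_left hne

/-- The symmetric multilinear mapping that generates a homogeneous polynomial is unique. -/
theorem IsGeneratedBy.unique {P : E → F} {A B : MultilinearMap 𝕜 (fun _ : Fin m => E) F}
    (hA : IsGeneratedBy P A) (hB : IsGeneratedBy P B) : A = B :=
  sub_eq_zero.1 <| (A - B).eq_zero_of_symm_of_diag
    (fun σ x => by simp [hA.1 σ x, hB.1 σ x]) (fun x => by simp [← hA.2 x, ← hB.2 x])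

theorem IsGeneratedBy.add {P Q : HomPoly 𝕜 m E F} {A B : MultilinearMap 𝕜 (fun _ : Fin m => E) F}
    (hP : IsGeneratedBy P A) (hQ : IsGeneratedBy Q B) :
    IsGeneratedBy (P + Q : HomPoly 𝕜 m E F) (A + B) :=
  ⟨fun σ x => by simp [hP.1 σ x, hQ.1 σ x], fun x => by simp [hP.2 x, hQ.2 x]⟩

theorem IsGeneratedBy.sub {P Q : HomPoly 𝕜 m E F} {A B : MultilinearMap 𝕜 (fun _ : Fin m => E) F}
    (hP : IsGeneratedBy P A) (hQ : IsGeneratedBy Q B) :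
    IsGeneratedBy (P - Q : HomPoly 𝕜 m E F) (A - B) :=
  ⟨fun σ x => by simp [hP.1 σ x, hQ.1 σ x], fun x => by simp [hP.2 x, hQ.2 x]⟩

theorem IsGeneratedBy.smul {P : HomPoly 𝕜 m E F} {A : MultilinearMap 𝕜 (fun _ : Fin m => E) F}
    (hP : IsGeneratedBy P A) (c : 𝕜) : IsGeneratedBy (c • P : HomPoly 𝕜 m E F) (c • A) :=
  ⟨fun σ x => by simp [hP.1 σ x], fun x => by simp [hP.2 x]⟩

end Polarization

/-! ### Riesz decomposition -/

section Riesz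

variable {E : Type*} [AddCommGroup E] [Lattice E] [IsOrderedAddMonoid E]

/-- The choice `p = a ⊓ x` forces the other three entries; only nonnegativity of the last one needs
an argument. -/
theorem exists_refinement_of_add_eq_add {a b x y : E} (ha : 0 ≤ a) (hb : 0 ≤ b) (hx : 0 ≤ x)
    (hy : 0 ≤ y) (h : a + b = x + y) :
    ∃ p q r s : E, 0 ≤ p ∧ 0 ≤ q ∧ 0 ≤ r ∧ 0 ≤ s ∧
      a = p + q ∧ b = r + s ∧ x = p + r ∧ y = q + s := by
  have hs : 0 ≤ y - (a - a ⊓ x) := by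
    have : a - y ≤ a ⊓ x :=
      le_inf (sub_le_self _ hy) (sub_le_iff_le_add.2 (h ▸ le_add_of_nonneg_right hb))
    rw [sub_nonneg, sub_le_comm]
    exact this
  refine ⟨a ⊓ x, a - a ⊓ x, x - a ⊓ x, y - (a - a ⊓ x), le_inf ha hx,
    sub_nonneg.2 inf_le_left, sub_nonneg.2 inf_le_right, hs, by abel, ?_, by abel, by abel⟩
  rw [eq_sub_of_add_eq' h]
  abel

/-- Greedy choice: remove `a ⊓ s i` from `a`; the remainder is dominated by the sum of the other
terms. -/
theorem exists_sum_eq_of_le_sum {ι : Type*} (t : Finset ι) (s : ι → E) (hs : ∀ i, 0 ≤ s i) {a : E}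
    (ha : 0 ≤ a) (has : a ≤ ∑ i ∈ t, s i) :
    ∃ c : ι → E, (∀ i, 0 ≤ c i ∧ c i ≤ s i) ∧ ∑ i ∈ t, c i = a := by
  classical
  induction t using Finset.induction_on generalizing a with
  | empty => exact ⟨0, fun i => ⟨le_rfl, hs i⟩, by simpa using ha.antisymm (by simpa using has)⟩
  | insert i t hi ih =>
    rw [Finset.sum_insert hi] at has
    have h1 : a - a ⊓ s i ≤ ∑ j ∈ t, s j := by
      have ht : 0 ≤ ∑ j ∈ t, s j := Finset.sum_nonneg fun j _ => hs j
      have : a - ∑ j ∈ t, s j ≤ a ⊓ s i := le_inf (sub_le_self _ ht) (sub_le_iff_le_add.2 has)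
      rwa [sub_le_comm]
    obtain ⟨c, hc, hca⟩ := ih (sub_nonneg.2 inf_le_left) h1
    refine ⟨Function.update c i (a ⊓ s i), fun j => ?_, ?_⟩
    · by_cases hj : j = i
      · subst hj
        simpa using ⟨ha, hs j⟩
      · simpa [hj] using hc j
    · rw [Finset.sum_insert hi, Function.update_self,
        Finset.sum_congr rfl fun j hj => Function.update_of_ne (ne_of_mem_of_not_mem hj hi) _ _, hca]
      abel

end Riesz

/-! ### Mappings on the positive cone -/

section Cone

variable {m : ℕ} {E F : Type*} [AddCommGroup E] [Lattice E] [IsOrderedAddMonoid E] [Module ℝ E]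
  [AddCommGroup F] [Module ℝ F]

theorem update_nonneg {x : Fin m → E} (hx : ∀ i, 0 ≤ x i) {u : E} (hu : 0 ≤ u) (j : Fin m) :
    ∀ i, 0 ≤ Function.update x j u i := by
  intro i
  by_cases h : i = j
  · subst h; simpa
  · simpa [h] using hx i

/-- A multilinear mapping is determined by its values on the positive cone. -/
theorem MultilinearMap.ext_of_nonneg {A B : MultilinearMap ℝ (fun _ : Fin m => E) F}
    (h : ∀ x : Fin m → E, (∀ i, 0 ≤ x i) → A x = B x) : A = B := by
  -- The induction is on the set `t` of coordinates of arbitrary sign; each new one is split into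
  -- positive and negative parts.
  suffices H : ∀ (t : Finset (Fin m)) (x : Fin m → E), (∀ i, i ∉ t → 0 ≤ x i) → A x = B x from
    MultilinearMap.ext fun x => H Finset.univ x (by simp)
  intro t
  induction t using Finset.induction_on with
  | empty => exact fun x hx => h x fun i => hx i (by simp)
  | insert j t hj ih =>
    intro x hx
    have hupd : ∀ u : E, 0 ≤ u → A (Function.update x j u) = B (Function.update x j u) := by
      refine fun u hu => ih _ fun i hi => ?_
      by_cases hij : i = j
      · subst hij; simpa
      · simpa [hij] using hx i (by simp [hij, hi])
    rw [← Function.update_eq_self j x, ← posPart_sub_negPart (x j), A.map_update_sub,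
      B.map_update_sub, hupd _ (posPart_nonneg _), hupd _ (negPart_nonneg _)]


end Cone

/-! ### Extension from the positive cone to the whole space. -/

section Extension

variable {m : ℕ} {E F : Type*} [AddCommGroup E] [Lattice E] [IsOrderedAddMonoid E] [Module ℝ E]
  [IsOrderedModule ℝ E] [AddCommGroup F] [Module ℝ F]

/-- Additivity applied to `w⁺ + v = u + w⁻`. The extension of `g` may thus be computed from any
representation as a difference of positive elements, which yields its linearity. -/
theorem map_posPart_sub_map_negPart {g : E → F}
    (hadd : ∀ u v, 0 ≤ u → 0 ≤ v → g (u + v) = g u + g v) {u v w : E} (hu : 0 ≤ u) (hv : 0 ≤ v)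
    (hw : w = u - v) : g w⁺ - g w⁻ = g u - g v := by
  have h : w⁺ + v = u + w⁻ := by
    have := posPart_sub_negPart w
    rwa [hw, sub_eq_sub_iff_add_eq_add, ← hw] at this
  have := congrArg g h
  rw [hadd _ _ (posPart_nonneg w) hv, hadd _ _ hu (negPart_nonneg w)] at this
  rw [sub_eq_sub_iff_add_eq_add, this]

/-- The linear extension of an additive and positively homogeneous mapping on the cone. -/
def linearOfCone (g : E → F) (hadd : ∀ u v, 0 ≤ u → 0 ≤ v → g (u + v) = g u + g v)
    (hsmul : ∀ (c : ℝ) u, 0 ≤ c → 0 ≤ u → g (c • u) = c • g u) : E →ₗ[ℝ] F where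
  toFun w := g w⁺ - g w⁻
  map_add' a b := by
    rw [map_posPart_sub_map_negPart hadd (add_nonneg (posPart_nonneg a) (posPart_nonneg b))
      (add_nonneg (negPart_nonneg a) (negPart_nonneg b)),
      hadd _ _ (posPart_nonneg a) (posPart_nonneg b),
      hadd _ _ (negPart_nonneg a) (negPart_nonneg b)]
    · abel
    · rw [add_sub_add_comm, posPart_sub_negPart, posPart_sub_negPart]
  map_smul' c a := by
    rw [RingHom.id_apply]
    rcases le_total 0 c with hc | hc
    · rw [map_posPart_sub_map_negPart hadd (smul_nonneg hc (posPart_nonneg a))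
        (smul_nonneg hc (negPart_nonneg a)), hsmul _ _ hc (posPart_nonneg a),
        hsmul _ _ hc (negPart_nonneg a), smul_sub]
      rw [← smul_sub, posPart_sub_negPart]
    · have hc' : 0 ≤ -c := neg_nonneg.2 hc
      rw [map_posPart_sub_map_negPart hadd (smul_nonneg hc' (negPart_nonneg a))
        (smul_nonneg hc' (posPart_nonneg a)), hsmul _ _ hc' (posPart_nonneg a),
        hsmul _ _ hc' (negPart_nonneg a)]
      · module
      · conv_lhs => rw [← posPart_sub_negPart a]
        module

/-- A mapping on the positive cone that is additive and positively homogeneous in each variable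
extends to a multilinear mapping. -/
theorem exists_multilinear_extension (f : (Fin m → E) → F)
    (hadd : ∀ (x : Fin m → E) (j : Fin m) (u v : E), (∀ i, 0 ≤ x i) → 0 ≤ u → 0 ≤ v →
      f (Function.update x j (u + v)) = f (Function.update x j u) + f (Function.update x j v))
    (hsmul : ∀ (x : Fin m → E) (j : Fin m) (c : ℝ) (u : E), (∀ i, 0 ≤ x i) → 0 ≤ c → 0 ≤ u →
      f (Function.update x j (c • u)) = c • f (Function.update x j u)) :
    ∃ A : MultilinearMap ℝ (fun _ : Fin m => E) F, ∀ x, (∀ i, 0 ≤ x i) → A x = f x := by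
  let p : Finset (Fin m) → (Fin m → E) → Fin m → E :=
    fun s x i => if i ∈ s then (x i)⁻ else (x i)⁺
  have hp : ∀ s x i, 0 ≤ p s x i := fun s x i => by
    simp only [p]
    split_ifs
    exacts [negPart_nonneg _, posPart_nonneg _]
  let T : Finset (Fin m) → (Fin m → E) → Fin m → E →ₗ[ℝ] F := fun s x j =>
    linearOfCone (fun u => f (Function.update (p s x) j u))
      (fun u v hu hv => hadd _ j u v (hp s x) hu hv)
      (fun c u hc hu => hsmul _ j c u (hp s x) hc hu)
  -- Pairing `s` with `insert j s` exhibits the alternating sum as a combination of the linear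
  -- extensions in the variable `j`.
  have key : ∀ (x : Fin m → E) (j : Fin m) (w : E),
      ∑ s : Finset (Fin m), (-1 : ℝ) ^ s.card • f (p s (Function.update x j w))
        = ∑ s ∈ (Finset.univ.erase j).powerset, (-1 : ℝ) ^ s.card • T s x j w := by
    intro x j w
    have huniv : (Finset.univ : Finset (Finset (Fin m)))
        = (insert j (Finset.univ.erase j)).powerset := by
      rw [Finset.insert_erase (Finset.mem_univ j), Finset.powerset_univ]
    rw [huniv, Finset.sum_powerset_insert (Finset.notMem_erase j _), ← Finset.sum_add_distrib]
    refine Finset.sum_congr rfl fun s hs => ?_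
    have hj : j ∉ s := fun h => by simpa using Finset.mem_powerset.1 hs h
    have h1 : p s (Function.update x j w) = Function.update (p s x) j w⁺ := by
      funext k
      by_cases h : k = j
      · subst h; simp [p, hj]
      · simp [p, h]
    have h2 : p (insert j s) (Function.update x j w) = Function.update (p s x) j w⁻ := by
      funext k
      by_cases h : k = j
      · subst h; simp [p]
      · simp [p, h]
    rw [h1, h2, Finset.card_insert_of_notMem hj, pow_succ]
    change _ = (-1 : ℝ) ^ s.card •
      (f (Function.update (p s x) j w⁺) - f (Function.update (p s x) j w⁻))
    module
  refine ⟨MultilinearMap.mk' (fun x => ∑ s : Finset (Fin m), (-1 : ℝ) ^ s.card • f (p s x))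
    (fun x j u v => ?_) (fun x j c u => ?_), fun x hx => ?_⟩
  · simp only [key, map_add, smul_add, Finset.sum_add_distrib]
  · simp only [key, map_smul, Finset.smul_sum]
    exact Finset.sum_congr rfl fun s _ => smul_comm _ _ _
  · change ∑ s : Finset (Fin m), (-1 : ℝ) ^ s.card • f (p s x) = _
    rw [Finset.sum_eq_single ∅]
    · have : p ∅ x = x := by
        funext i
        simp [p, hx i]
      simp [this]
    · intro s _ hs
      obtain ⟨j, hj⟩ := Finset.nonempty_iff_ne_empty.2 hs
      -- The `j`-th entry is `(x j)⁻ = 0`; written as `0 • 0`, it lets homogeneity with `c = 0` kill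
      -- the term.
      have h0 : p s x = Function.update (p s x) j ((0 : ℝ) • (0 : E)) := by
        rw [zero_smul]
        exact (Function.update_eq_self_iff.2 (by simp [p, hj, hx j])).symm
      rw [h0, hsmul _ _ _ _ (hp s x) le_rfl le_rfl, zero_smul, smul_zero]
    · simp

end Extension

/-! ### The modulus of a multilinear mapping -/

section Modulus

variable {m : ℕ} {E F : Type*} [AddCommGroup E] [Lattice E] [IsOrderedAddMonoid E] [Module ℝ E]
  [AddCommGroup F] [Lattice F] [IsOrderedAddMonoid F] [Module ℝ F]

/-- `SignedBoxSum A x g`: the value `g` is a sum of terms `± A y`, where `y` ranges over a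
subdivision of `x ≥ 0` obtained by successively splitting single coordinates into sums of positive
elements. -/
inductive SignedBoxSum (A : MultilinearMap ℝ (fun _ : Fin m => E) F) : (Fin m → E) → F → Prop
  | pos (x : Fin m → E) (hx : ∀ i, 0 ≤ x i) : SignedBoxSum A x (A x)
  | neg (x : Fin m → E) (hx : ∀ i, 0 ≤ x i) : SignedBoxSum A x (-A x)
  | split (x : Fin m → E) (j : Fin m) (u v : E) (g h : F) (hu : 0 ≤ u) (hv : 0 ≤ v) :
      SignedBoxSum A (Function.update x j u) g → SignedBoxSum A (Function.update x j v) h →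
      SignedBoxSum A (Function.update x j (u + v)) (g + h)

namespace SignedBoxSum

variable {A : MultilinearMap ℝ (fun _ : Fin m => E) F}

/-- Two splittings of the same coordinate have a common refinement by Riesz decomposition, and
splittings of different coordinates commute. This gives the nontrivial inclusion in
`setOf_update_add`. -/
theorem exists_split {x : Fin m → E} {g : F} (h : SignedBoxSum A x g) :
    ∀ (j : Fin m) (u v : E), 0 ≤ u → 0 ≤ v → x j = u + v →
      ∃ g₁ g₂, SignedBoxSum A (Function.update x j u) g₁ ∧
        SignedBoxSum A (Function.update x j v) g₂ ∧ g = g₁ + g₂ := by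
  induction h with
  | pos x hx =>
    intro j u v hu hv hj
    refine ⟨_, _, .pos _ (update_nonneg hx hu j), .pos _ (update_nonneg hx hv j), ?_⟩
    rw [← A.map_update_add, ← hj, Function.update_eq_self]
  | neg x hx =>
    intro j u v hu hv hj
    refine ⟨_, _, .neg _ (update_nonneg hx hu j), .neg _ (update_nonneg hx hv j), ?_⟩
    rw [← neg_add, ← A.map_update_add, ← hj, Function.update_eq_self]
  | split x k u' v' g h hu' hv' _ _ ihg ihh =>
    intro j u v hu hv hj
    by_cases hjk : j = k
    · subst hjk
      rw [Function.update_self] at hj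
      obtain ⟨a, b, c, d, ha, hb, hc, hd, rfl, rfl, rfl, rfl⟩ :=
        exists_refinement_of_add_eq_add hu' hv' hu hv hj
      obtain ⟨g₁, g₂, hg₁, hg₂, rfl⟩ := ihg j a b ha hb (by simp)
      obtain ⟨h₁, h₂, hh₁, hh₂, rfl⟩ := ihh j c d hc hd (by simp)
      simp only [Function.update_idem] at *
      exact ⟨_, _, .split x j a c _ _ ha hc hg₁ hh₁, .split x j b d _ _ hb hd hg₂ hh₂, by abel⟩
    · obtain ⟨g₁, g₂, hg₁, hg₂, rfl⟩ := ihg j u v hu hv (by simpa [hjk] using hj)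
      obtain ⟨h₁, h₂, hh₁, hh₂, rfl⟩ := ihh j u v hu hv (by simpa [hjk] using hj)
      simp only [Function.update_comm (Ne.symm hjk)] at *
      exact ⟨_, _, .split _ k u' v' _ _ hu' hv' hg₁ hh₁, .split _ k u' v' _ _ hu' hv' hg₂ hh₂,
        by abel⟩

theorem smul [IsOrderedModule ℝ E] {x : Fin m → E} {g : F} (h : SignedBoxSum A x g) (j : Fin m)
    {c : ℝ} (hc : 0 ≤ c) : SignedBoxSum A (Function.update x j (c • x j)) (c • g) := by
  induction h with
  | pos x hx =>
    convert SignedBoxSum.pos (A := A) _ (update_nonneg hx (smul_nonneg hc (hx j)) j) using 1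
    rw [A.map_update_smul, Function.update_eq_self]
  | neg x hx =>
    convert SignedBoxSum.neg (A := A) _ (update_nonneg hx (smul_nonneg hc (hx j)) j) using 1
    rw [A.map_update_smul, Function.update_eq_self, smul_neg]
  | split x k u v g h hu hv _ _ ihg ihh =>
    rw [smul_add]
    by_cases hjk : j = k
    · subst hjk
      simp only [Function.update_idem, Function.update_self] at *
      rw [smul_add]
      exact .split x j _ _ _ _ (smul_nonneg hc hu) (smul_nonneg hc hv) ihg ihh
    · simp only [Function.update_of_ne hjk, Function.update_comm (Ne.symm hjk)] at *
      exact .split _ k u v _ _ hu hv ihg ihh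

/-- Domination on each box adds up by multilinearity of `C`. It provides both the upper bound needed
for the supremum to exist and the minimality of the modulus. -/
theorem le {C : MultilinearMap ℝ (fun _ : Fin m => E) F}
    (h₁ : ∀ x : Fin m → E, (∀ i, 0 ≤ x i) → A x ≤ C x)
    (h₂ : ∀ x : Fin m → E, (∀ i, 0 ≤ x i) → -A x ≤ C x) {x : Fin m → E} {g : F}
    (h : SignedBoxSum A x g) : g ≤ C x := by
  induction h with
  | pos x hx => exact h₁ x hx
  | neg x hx => exact h₂ x hx
  | split x j u v g h _ _ _ _ ihg ihh =>
    rw [C.map_update_add]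
    exact add_le_add ihg ihh

theorem setOf_update_add (A : MultilinearMap ℝ (fun _ : Fin m => E) F) (x : Fin m → E) (j : Fin m)
    {u v : E} (hu : 0 ≤ u) (hv : 0 ≤ v) :
    {g | SignedBoxSum A (Function.update x j (u + v)) g}
      = Set.image2 (· + ·) {g | SignedBoxSum A (Function.update x j u) g}
        {g | SignedBoxSum A (Function.update x j v) g} := by
  ext g
  constructor
  · intro hg
    obtain ⟨g₁, g₂, h₁, h₂, rfl⟩ := exists_split hg j u v hu hv (by simp)
    rw [Function.update_idem] at h₁ h₂
    exact ⟨g₁, h₁, g₂, h₂, rfl⟩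
  · rintro ⟨g₁, h₁, g₂, h₂, rfl⟩
    exact .split x j u v _ _ hu hv h₁ h₂

theorem setOf_update_smul [IsOrderedModule ℝ E] (A : MultilinearMap ℝ (fun _ : Fin m => E) F)
    (x : Fin m → E) (j : Fin m) (u : E) {c : ℝ} (hc : 0 < c) :
    {g | SignedBoxSum A (Function.update x j (c • u)) g}
      = (fun g => c • g) '' {g | SignedBoxSum A (Function.update x j u) g} := by
  ext g
  constructor
  · intro hg
    refine ⟨c⁻¹ • g, ?_, smul_inv_smul₀ hc.ne' g⟩
    have := hg.smul j (inv_nonneg.2 hc.le)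
    rwa [Function.update_idem, Function.update_self, inv_smul_smul₀ hc.ne'] at this
  · rintro ⟨g, hg, rfl⟩
    have := hg.smul j hc.le
    rwa [Function.update_idem, Function.update_self] at this

end SignedBoxSum

/-- An order bounded multilinear mapping into a Dedekind complete space has a modulus. -/
theorem exists_multilinear_modulus [IsOrderedModule ℝ E] [IsOrderedModule ℝ F]
    (hF : DedekindComplete F)
    (A B : MultilinearMap ℝ (fun _ : Fin m => E) F)
    (h₁ : ∀ x : Fin m → E, (∀ i, 0 ≤ x i) → A x ≤ B x)
    (h₂ : ∀ x : Fin m → E, (∀ i, 0 ≤ x i) → -A x ≤ B x) :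
    ∃ R : MultilinearMap ℝ (fun _ : Fin m => E) F,
      (∀ x : Fin m → E, (∀ i, 0 ≤ x i) → A x ≤ R x) ∧
      (∀ x : Fin m → E, (∀ i, 0 ≤ x i) → -A x ≤ R x) ∧
      ∀ C : MultilinearMap ℝ (fun _ : Fin m => E) F,
        (∀ x : Fin m → E, (∀ i, 0 ≤ x i) → A x ≤ C x) →
        (∀ x : Fin m → E, (∀ i, 0 ≤ x i) → -A x ≤ C x) →
        ∀ x : Fin m → E, (∀ i, 0 ≤ x i) → R x ≤ C x := by
  have hex : ∀ x : Fin m → E, ∃ r, (∀ i, 0 ≤ x i) → IsLUB {g | SignedBoxSum A x g} r := by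
    intro x
    by_cases hx : ∀ i, 0 ≤ x i
    · obtain ⟨r, hr⟩ := hF {g | SignedBoxSum A x g} ⟨_, .pos x hx⟩
        ⟨B x, fun g hg => SignedBoxSum.le h₁ h₂ hg⟩
      exact ⟨r, fun _ => hr⟩
    -- Off the cone the value is irrelevant.
    · exact ⟨0, fun h => absurd h hx⟩
  choose f hf using hex
  have hadd : ∀ (x : Fin m → E) (j : Fin m) (u v : E), (∀ i, 0 ≤ x i) → 0 ≤ u → 0 ≤ v →
      f (Function.update x j (u + v))
        = f (Function.update x j u) + f (Function.update x j v) := by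
    intro x j u v hx hu hv
    have h := (hf _ (update_nonneg hx hu j)).add (hf _ (update_nonneg hx hv j))
    have h' := hf _ (update_nonneg hx (add_nonneg hu hv) j)
    rw [SignedBoxSum.setOf_update_add A x j hu hv] at h'
    -- The supremum of a sum of two sets is the sum of their suprema.
    exact h'.unique h
  have hsmul : ∀ (x : Fin m → E) (j : Fin m) (c : ℝ) (u : E), (∀ i, 0 ≤ x i) → 0 ≤ c → 0 ≤ u →
      f (Function.update x j (c • u)) = c • f (Function.update x j u) := by
    intro x j c u hx hc hu
    -- The scaling of sets needs `c > 0`; for `c = 0`, additivity at `0 + 0` forces the value zero.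
    rcases hc.eq_or_lt with rfl | hc
    · have := hadd x j 0 0 hx le_rfl le_rfl
      rw [add_zero, left_eq_add] at this
      rw [zero_smul, zero_smul, this]
    · have h := hf _ (update_nonneg hx hu j)
      have h' := hf _ (update_nonneg hx (smul_nonneg hc.le hu) j)
      rw [SignedBoxSum.setOf_update_smul A x j u hc] at h'
      refine h'.unique ⟨?_, fun b hb => ?_⟩
      · rintro _ ⟨g, hg, rfl⟩
        exact smul_le_smul_of_nonneg_left (h.1 hg) hc.le
      · rw [← le_inv_smul_iff_of_pos hc]
        refine h.2 fun g hg => ?_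
        rw [le_inv_smul_iff_of_pos hc]
        exact hb ⟨g, hg, rfl⟩
  obtain ⟨R, hR⟩ := exists_multilinear_extension f hadd hsmul
  refine ⟨R, fun x hx => ?_, fun x hx => ?_, fun C hC₁ hC₂ x hx => ?_⟩
  · rw [hR x hx]
    exact (hf x hx).1 (.pos x hx)
  · rw [hR x hx]
    exact (hf x hx).1 (.neg x hx)
  · rw [hR x hx]
    exact (hf x hx).2 fun g hg => hg.le hC₁ hC₂

/-- The modulus of a symmetric multilinear mapping is symmetric. -/
theorem symm_of_isLeast_modulus {A R : MultilinearMap ℝ (fun _ : Fin m => E) F}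
    (hA : ∀ (σ : Equiv.Perm (Fin m)) (x : Fin m → E), A (fun i => x (σ i)) = A x)
    (h₁ : ∀ x : Fin m → E, (∀ i, 0 ≤ x i) → A x ≤ R x)
    (h₂ : ∀ x : Fin m → E, (∀ i, 0 ≤ x i) → -A x ≤ R x)
    (h₃ : ∀ C : MultilinearMap ℝ (fun _ : Fin m => E) F,
        (∀ x : Fin m → E, (∀ i, 0 ≤ x i) → A x ≤ C x) →
        (∀ x : Fin m → E, (∀ i, 0 ≤ x i) → -A x ≤ C x) →
        ∀ x : Fin m → E, (∀ i, 0 ≤ x i) → R x ≤ C x)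
    (σ : Equiv.Perm (Fin m)) (x : Fin m → E) : R (fun i => x (σ i)) = R x := by
  -- Permuting the arguments of `R` gives another majorant of `± A`, so minimality applies; using it
  -- for `σ` and `σ⁻¹` gives equality on the cone.
  have hle : ∀ (τ : Equiv.Perm (Fin m)) (x : Fin m → E), (∀ i, 0 ≤ x i) →
      R x ≤ R fun i => x (τ i) := by
    intro τ
    refine h₃ (R.domDomCongr τ) (fun x hx => ?_) (fun x hx => ?_)
    · rw [← hA τ x]
      exact h₁ _ fun i => hx _
    · rw [← hA τ x]
      exact h₂ _ fun i => hx _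
  suffices H : R.domDomCongr σ = R from DFunLike.congr_fun H x
  refine MultilinearMap.ext_of_nonneg fun x hx => le_antisymm ?_ (hle σ x hx)
  have := hle σ⁻¹ (fun i => x (σ i)) fun i => hx _
  simpa using this

end Modulus

/-! ### Decomposition of complex elements into positive elements -/

section Sector

variable {E : Type*} [AddCommGroup E] [Lattice E] [IsOrderedAddMonoid E] [Module ℝ E]
  [IsOrderedModule ℝ E]

/-- `x + i y` is a finite sum of elements `exp (i θ) w` with `w ≥ 0` and `α ≤ θ ≤ β`, where the sum
of the elements `w` is at most `s`. -/
def HasSectorDecomposition (α β : ℝ) (x y s : E) : Prop :=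
  ∃ (ι : Type) (_ : Fintype ι) (θ : ι → ℝ) (w : ι → E), (∀ i, 0 ≤ w i) ∧
    (∀ i, α ≤ θ i ∧ θ i ≤ β) ∧ ∑ i, Real.cos (θ i) • w i = x ∧ ∑ i, Real.sin (θ i) • w i = y ∧
    ∑ i, w i ≤ s

theorem HasSectorDecomposition.rotate {α β : ℝ} {x y s : E} (h : HasSectorDecomposition α β x y s)
    (δ : ℝ) : HasSectorDecomposition (α + δ) (β + δ) (Real.cos δ • x - Real.sin δ • y)
      (Real.sin δ • x + Real.cos δ • y) s := by
  obtain ⟨ι, _, θ, w, hw, hθ, rfl, rfl, hs⟩ := h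
  refine ⟨ι, _, fun i => θ i + δ, w, hw,
    fun i => ⟨by linarith [(hθ i).1], by linarith [(hθ i).2]⟩, ?_, ?_, hs⟩
  · simp only [Finset.smul_sum, ← Finset.sum_sub_distrib, Real.cos_add]
    exact Finset.sum_congr rfl fun i _ => by module
  · simp only [Finset.smul_sum, ← Finset.sum_add_distrib, Real.sin_add]
    exact Finset.sum_congr rfl fun i _ => by module

/-- Since `y⁺ ≤ |y|`, each `w i` splits as `p i + q i` so that the `p i` carry `y⁺` and the `q i`
carry `y⁻`. Reflecting the `q i` to the angles `-θ i` changes neither the cosine sum nor the total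
mass. -/
theorem HasSectorDecomposition.unfold {δ : ℝ} (hδ : δ ≤ Real.pi) {x y s : E}
    (h : HasSectorDecomposition 0 δ x |y| s) : HasSectorDecomposition (-δ) δ x y s := by
  obtain ⟨ι, _, θ, w, hw, hθ, rfl, hy, hs⟩ := h
  have hsin : ∀ i, 0 ≤ Real.sin (θ i) := fun i =>
    Real.sin_nonneg_of_nonneg_of_le_pi (hθ i).1 ((hθ i).2.trans hδ)
  obtain ⟨c, hc, hcy⟩ := exists_sum_eq_of_le_sum Finset.univ (fun i => Real.sin (θ i) • w i)
    (fun i => smul_nonneg (hsin i) (hw i)) (posPart_nonneg y)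
    (by rw [hy, ← posPart_add_negPart]; exact le_add_of_nonneg_right (negPart_nonneg y))
  have hex : ∀ i, ∃ p q : E, 0 ≤ p ∧ 0 ≤ q ∧ w i = p + q ∧ Real.sin (θ i) • p = c i := by
    intro i
    -- If the sine vanishes, then `c i = 0` and any splitting would do.
    rcases (hsin i).eq_or_lt with h0 | h0
    · refine ⟨0, w i, le_rfl, hw i, by simp, ?_⟩
      have := hc i
      rw [← h0, zero_smul] at this
      rw [smul_zero, this.1.antisymm this.2]
    · refine ⟨(Real.sin (θ i))⁻¹ • c i, w i - (Real.sin (θ i))⁻¹ • c i,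
        smul_nonneg (inv_nonneg.2 h0.le) (hc i).1, ?_, by abel, smul_inv_smul₀ h0.ne' _⟩
      rw [sub_nonneg, inv_smul_le_iff_of_pos h0]
      exact (hc i).2
  choose p q hp hq hpq hpc using hex
  have hsum : ∑ i, p i + ∑ i, q i = ∑ i, w i := by
    rw [← Finset.sum_add_distrib]
    exact Finset.sum_congr rfl fun i _ => (hpq i).symm
  refine ⟨ι ⊕ ι, inferInstance, Sum.elim θ fun i => -θ i, Sum.elim p q, ?_, ?_, ?_, ?_, ?_⟩
  · rintro (i | i)
    exacts [hp i, hq i]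
  · rintro (i | i)
    · have := hθ i
      exact ⟨by simp only [Sum.elim_inl]; linarith, this.2⟩
    · have := hθ i
      exact ⟨by simp only [Sum.elim_inr]; linarith, by simp only [Sum.elim_inr]; linarith⟩
  · simp only [Fintype.sum_sum_type, Sum.elim_inl, Sum.elim_inr, Real.cos_neg,
      ← Finset.sum_add_distrib, ← smul_add, ← hpq]
  · simp only [Fintype.sum_sum_type, Sum.elim_inl, Sum.elim_inr, Real.sin_neg, neg_smul,
      Finset.sum_neg_distrib]
    have h1 : ∑ i, Real.sin (θ i) • p i = y⁺ := by rw [← hcy]; simp only [hpc]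
    have h2 : ∑ i, Real.sin (θ i) • p i + ∑ i, Real.sin (θ i) • q i = |y| := by
      rw [← hy, ← Finset.sum_add_distrib]
      exact Finset.sum_congr rfl fun i _ => by rw [hpq i, smul_add]
    rw [h1, ← posPart_add_negPart, add_right_inj] at h2
    rw [h1, h2, ← sub_eq_add_neg, posPart_sub_negPart]
  · simpa [Fintype.sum_sum_type, hsum] using hs

/-- Upper bounds of the rotations of `x + i y` are upper bounds of the rotations of `x + i |y|`. -/
theorem rotation_abs_le {x y s : E} (h : ∀ t : ℝ, Real.cos t • x + Real.sin t • y ≤ s) (t : ℝ) :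
    Real.cos t • x + Real.sin t • |y| ≤ s := by
  rcases lt_or_ge 0 (Real.sin t) with ht | ht
  · rw [← le_sub_iff_add_le', ← le_inv_smul_iff_of_pos ht]
    refine abs_le'.2 ⟨?_, ?_⟩
    · rw [le_inv_smul_iff_of_pos ht, le_sub_iff_add_le']
      exact h t
    · rw [le_inv_smul_iff_of_pos ht, le_sub_iff_add_le']
      simpa using h (-t)
  · refine le_trans (add_le_add_right ?_ _) (h t)
    exact smul_le_smul_of_nonpos_left (le_abs_self y) ht

/-- Every element of the sector `0 ≤ arg z ≤ δ` can be decomposed, with constant `C`. -/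
def SectorDecomposable (E : Type*) [AddCommGroup E] [Lattice E] [Module ℝ E] (δ C : ℝ) : Prop :=
  ∀ x y s : E, 0 ≤ y → 0 ≤ Real.sin δ • x - Real.cos δ • y →
    (∀ t : ℝ, Real.cos t • x + Real.sin t • y ≤ s) → HasSectorDecomposition 0 δ x y (C • s)

/-- Solving for coefficients along the two edges of the sector gives `z = a + exp (i δ) b` with `a,
b ≥ 0`. Projecting on the bisector, `cos (δ / 2) • (a + b)` is the rotation at angle `δ / 2`, hence
at most `s`. -/
theorem sectorDecomposable_of_lt_pi {δ : ℝ} (h0 : 0 < δ) (hpi : δ < Real.pi) :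
    SectorDecomposable E δ (Real.cos (δ / 2))⁻¹ := by
  intro x y s hy hx hs
  have hsin : 0 < Real.sin δ := Real.sin_pos_of_pos_of_lt_pi h0 hpi
  have hcos : 0 < Real.cos (δ / 2) := Real.cos_pos_of_mem_Ioo ⟨by linarith, by linarith⟩
  refine ⟨Bool, inferInstance, fun b => bif b then δ else 0,
    fun b => (Real.sin δ)⁻¹ • bif b then y else Real.sin δ • x - Real.cos δ • y, ?_, ?_, ?_, ?_, ?_⟩
  · rintro (_ | _)
    exacts [smul_nonneg (inv_nonneg.2 hsin.le) hx, smul_nonneg (inv_nonneg.2 hsin.le) hy]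
  · rintro (_ | _)
    exacts [⟨le_rfl, h0.le⟩, ⟨h0.le, le_rfl⟩]
  · simp only [Fintype.sum_bool, cond_true, cond_false, Real.cos_zero]
    match_scalars <;> field_simp; ring
  · simp only [Fintype.sum_bool, cond_true, cond_false, Real.sin_zero]
    match_scalars <;> field_simp
    ring
  · simp only [Fintype.sum_bool, cond_true, cond_false]
    rw [le_inv_smul_iff_of_pos hcos]
    refine le_of_eq_of_le ?_ (hs (δ / 2))
    have h2 : Real.sin δ = 2 * Real.sin (δ / 2) * Real.cos (δ / 2) := by
      rw [← Real.sin_two_mul]; congr 1; ring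
    have h3 : Real.cos δ = 1 - 2 * Real.sin (δ / 2) ^ 2 := by
      rw [← Real.cos_two_mul_eq_one_sub]; congr 1; ring
    match_scalars
    · rw [h2] at hsin
      rw [h2, h3]
      have : Real.sin (δ / 2) ≠ 0 := by
        rintro h
        simp [h] at hsin
      field_simp
      ring
    · field_simp

/-- Rotation by `-δ` centres the sector on the real axis, and passing to `|y'|` folds it onto the
sector of angle `δ`. Unfolding and rotating back preserve the masses, so `C` does not deteriorate.
-/
theorem SectorDecomposable.double {δ C : ℝ} (h : SectorDecomposable E δ C) (h0 : 0 < δ)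
    (hδ : δ ≤ Real.pi / 2) : SectorDecomposable E (2 * δ) C := by
  intro x y s hy hx hs
  have hcos : 0 ≤ Real.cos δ := Real.cos_nonneg_of_mem_Icc ⟨by linarith, hδ⟩
  have hsq : Real.sin δ ^ 2 + Real.cos δ ^ 2 = 1 := Real.sin_sq_add_cos_sq δ
  set x' := Real.cos δ • x + Real.sin δ • y with hx'
  set y' := -Real.sin δ • x + Real.cos δ • y with hy'
  have hrot : ∀ t : ℝ, Real.cos t • x' + Real.sin t • y' ≤ s := by
    intro t
    refine le_of_eq_of_le ?_ (hs (t + δ))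
    rw [Real.cos_add, Real.sin_add, hx', hy']
    module
  have hsec : 0 ≤ Real.sin δ • x' - Real.cos δ • |y'| := by
    rw [sub_nonneg]
    rcases hcos.eq_or_lt with hc | hc
    · rw [← hc, zero_smul]
      have hs0 : 0 ≤ Real.sin δ := Real.sin_nonneg_of_nonneg_of_le_pi h0.le (by linarith)
      have : x' = Real.sin δ • y := by rw [hx', ← hc, zero_smul, zero_add]
      rw [this]
      exact smul_nonneg hs0 (smul_nonneg hs0 hy)
    · rw [← le_inv_smul_iff_of_pos hc]
      -- The bounds for `y'` and `-y'` are exactly the conditions at the two edges of the original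
      -- sector.
      refine abs_le'.2 ⟨?_, ?_⟩ <;> rw [le_inv_smul_iff_of_pos hc, ← sub_nonneg]
      · refine le_of_le_of_eq hx ?_
        rw [hx', hy', Real.sin_two_mul, Real.cos_two_mul']
        module
      · refine le_of_le_of_eq hy ?_
        rw [hx', hy']
        match_scalars
        · linear_combination -hsq
        · ring
  have hdec := ((h x' |y'| s (abs_nonneg y') hsec (rotation_abs_le hrot)).unfold
    (by linarith)).rotate δ
  rw [neg_add_cancel, ← two_mul] at hdec
  convert hdec using 1
  · rw [hx', hy']
    match_scalars
    · linear_combination -hsq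
    · ring
  · rw [hx', hy']
    match_scalars
    · linear_combination -hsq
    · ring

/-- A sector of angle `π / 2 ^ (n + 1)`, whose half-angle gives the constant, is doubled `n + 1`
times. The constant tends to one as `n` grows. -/
theorem sectorDecomposable_pi (n : ℕ) :
    SectorDecomposable E Real.pi (Real.cos (Real.pi / 2 ^ (n + 2)))⁻¹ := by
  have hpi := Real.pi_pos
  have H : ∀ (n : ℕ) (C : ℝ), SectorDecomposable E (Real.pi / 2 ^ n) C →
      SectorDecomposable E Real.pi C := by
    intro n C
    induction n with
    | zero => simp
    | succ n ih =>
      intro h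
      refine ih ?_
      have := h.double (by positivity) (by
        rw [pow_succ]
        gcongr
        exact le_mul_of_one_le_left (by norm_num) (one_le_pow₀ (by norm_num)))
      rwa [show 2 * (Real.pi / 2 ^ (n + 1)) = Real.pi / 2 ^ n by rw [pow_succ]; field_simp] at this
  refine H (n + 1) _ ?_
  have := sectorDecomposable_of_lt_pi (E := E) (δ := Real.pi / 2 ^ (n + 1)) (by positivity)
    (div_lt_self hpi (one_lt_pow₀ (by norm_num) (by omega)))
  rwa [show Real.pi / 2 ^ (n + 1) / 2 = Real.pi / 2 ^ (n + 2) by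
    rw [pow_succ _ (n + 1)]; field_simp] at this

/-- If `s` is an upper bound of the rotations of `x + i y`, then `x + i y` is a finite sum of
elements `exp (i θ) w` with `w ≥ 0`, where the sum of the elements `w` is almost at most `s`. -/
theorem hasSectorDecomposition_of_rotation_le {x y s : E}
    (h : ∀ t : ℝ, Real.cos t • x + Real.sin t • y ≤ s) (n : ℕ) :
    HasSectorDecomposition (-Real.pi) Real.pi x y ((Real.cos (Real.pi / 2 ^ (n + 2)))⁻¹ • s) :=
  (sectorDecomposable_pi n x |y| s (abs_nonneg y) (by simp) (rotation_abs_le h)).unfold le_rfl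

end Sector

/-! ### Positive multilinear mappings -/

section Positive

variable {m : ℕ} {E F : Type*}
  [AddCommGroup E] [Lattice E] [IsOrderedAddMonoid E] [Module ℝ E]
  [AddCommGroup F] [Lattice F] [IsOrderedAddMonoid F] [Module ℝ F]

/-- Expanding `A (x + (y - x))` over subsets gives nonnegative terms, one of which is `A x`. -/
theorem MultilinearMap.mono_of_nonneg {A : MultilinearMap ℝ (fun _ : Fin m => E) F}
    (hA : ∀ x : Fin m → E, (∀ i, 0 ≤ x i) → 0 ≤ A x) {x y : Fin m → E} (hx : ∀ i, 0 ≤ x i)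
    (hxy : ∀ i, x i ≤ y i) : A x ≤ A y := by
  have h := A.map_add_univ x (y - x)
  rw [add_sub_cancel] at h
  rw [h]
  refine le_of_eq_of_le ?_ (Finset.single_le_sum (f := fun s : Finset (Fin m) =>
    A (s.piecewise x (y - x))) (fun s _ => hA _ fun i => ?_) (Finset.mem_univ Finset.univ))
  · simp
  · by_cases hi : i ∈ s
    · simpa [hi] using hx i
    · simpa [hi] using hxy i

theorem MultilinearMap.complexify_apply_ofReal (A : MultilinearMap ℝ (fun _ : Fin m => E) F)
    (x : Fin m → E) :
    A.complexify (fun i => Complexification.ofReal (x i)) = Complexification.ofReal (A x) := by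
  rw [MultilinearMap.complexify_apply, Finset.sum_eq_single ∅]
  · rw [Finset.card_empty, pow_zero, one_smul]
    rfl
  · intro s _ hs
    obtain ⟨j, hj⟩ := Finset.nonempty_iff_ne_empty.2 hs
    rw [A.map_coord_zero j (by simp [selectParts, hj, Complexification.ofReal])]
    ext <;> simp [Complexification.ofReal]
  · simp

theorem Complexification.sum_re {ι : Type*} (t : Finset ι) (f : ι → Complexification E) :
    (∑ i ∈ t, f i).re = ∑ i ∈ t, (f i).re :=
  map_sum (AddMonoidHom.mk' Complexification.re Complexification.add_re) f t

theorem Complexification.sum_im {ι : Type*} (t : Finset ι) (f : ι → Complexification E) :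
    (∑ i ∈ t, f i).im = ∑ i ∈ t, (f i).im :=
  map_sum (AddMonoidHom.mk' Complexification.im Complexification.add_im) f t

theorem Complexification.rotation_smul_ofReal_le [IsOrderedModule ℝ F] {c : ℂ} (hc : ‖c‖ ≤ 1)
    {a : F} (ha : 0 ≤ a) (t : ℝ) :
    Real.cos t • (c • ofReal a).re + Real.sin t • (c • ofReal a).im ≤ a := by
  have h1 : Real.cos t * c.re + Real.sin t * c.im ≤ 1 := by
    have h2 : c.re ^ 2 + c.im ^ 2 ≤ 1 := by
      have := Complex.sq_norm c
      rw [Complex.normSq_apply] at this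
      nlinarith [norm_nonneg c]
    nlinarith [sq_nonneg (Real.cos t - c.re), sq_nonneg (Real.sin t - c.im),
      Real.sin_sq_add_cos_sq t]
  calc _ = (Real.cos t * c.re + Real.sin t * c.im) • a := by
        simp only [smul_re, smul_im, ofReal]
        module
    _ ≤ (1 : ℝ) • a := smul_le_smul_of_nonneg_right h1 ha
    _ = a := one_smul _ _

/-- Rotations of `A_ℂ (z, …, z)` are dominated by `A (s, …, s)` up to a constant close to one, if
`s` dominates the rotations of `z` and `A` is positive. -/
theorem rotation_complexify_le_smul [IsOrderedModule ℝ E] [IsOrderedModule ℝ F]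
    {A : MultilinearMap ℝ (fun _ : Fin m => E) F}
    (hA : ∀ x : Fin m → E, (∀ i, 0 ≤ x i) → 0 ≤ A x) {z : Complexification E} {s : E}
    (hs : ∀ t : ℝ, Real.cos t • z.re + Real.sin t • z.im ≤ s) (n : ℕ) (t : ℝ) :
    Real.cos t • (A.complexify fun _ => z).re + Real.sin t • (A.complexify fun _ => z).im
      ≤ ((Real.cos (Real.pi / 2 ^ (n + 2)))⁻¹) ^ m • A fun _ => s := by
  obtain ⟨ι, _, θ, w, hw, -, hre, him, hsum⟩ := hasSectorDecomposition_of_rotation_le hs n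
  have hz : z = ∑ i, Complex.exp (θ i * Complex.I) • Complexification.ofReal (w i) := by
    ext
    · rw [Complexification.sum_re, ← hre]
      refine Finset.sum_congr rfl fun i _ => ?_
      rw [Complexification.smul_re, Complex.exp_ofReal_mul_I_re]
      simp [Complexification.ofReal]
    · rw [Complexification.sum_im, ← him]
      refine Finset.sum_congr rfl fun i _ => ?_
      rw [Complexification.smul_im, Complex.exp_ofReal_mul_I_im]
      simp [Complexification.ofReal]
  have hexp : (A.complexify fun _ => z) = ∑ κ : Fin m → ι,
      (∏ j, Complex.exp (θ (κ j) * Complex.I)) •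
        Complexification.ofReal (A fun j => w (κ j)) := by
    classical
    rw [hz, MultilinearMap.map_sum]
    refine Finset.sum_congr rfl fun κ _ => ?_
    rw [A.complexify.map_smul_univ (fun j => Complex.exp (θ (κ j) * Complex.I))
      fun j => Complexification.ofReal (w (κ j)), A.complexify_apply_ofReal]
  calc _ = ∑ κ : Fin m → ι, (Real.cos t • ((∏ j, Complex.exp (θ (κ j) * Complex.I)) •
            Complexification.ofReal (A fun j => w (κ j))).re
          + Real.sin t • ((∏ j, Complex.exp (θ (κ j) * Complex.I)) •
            Complexification.ofReal (A fun j => w (κ j))).im) := by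
        rw [hexp, Complexification.sum_re, Complexification.sum_im, Finset.smul_sum,
          Finset.smul_sum, Finset.sum_add_distrib]
    -- Every coefficient is a product of unimodular numbers and every `A fun j => w (κ j)` is
    -- nonnegative.
    _ ≤ ∑ κ : Fin m → ι, A fun j => w (κ j) := by
        refine Finset.sum_le_sum fun κ _ => ?_
        refine Complexification.rotation_smul_ofReal_le ?_ (hA _ fun j => hw _) t
        simp [Complex.norm_exp_ofReal_mul_I]
    _ = A fun _ => ∑ i, w i := by
        classical
        rw [MultilinearMap.map_sum]
    _ ≤ A fun _ => (Real.cos (Real.pi / 2 ^ (n + 2)))⁻¹ • s :=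
        A.mono_of_nonneg hA (fun _ => Finset.sum_nonneg fun i _ => hw i) fun _ => hsum
    _ = _ := by
        rw [A.map_smul_univ (fun _ => (Real.cos (Real.pi / 2 ^ (n + 2)))⁻¹) fun _ => s]
        simp only [Finset.prod_const, Finset.card_univ, Fintype.card_fin]

end Positive

/-! ### Modulus inequality and sup norms of positive polynomials. -/

section Norms

variable {m : ℕ} {E F : Type*}
  [NormedAddCommGroup E] [Lattice E] [HasSolidNorm E] [IsOrderedAddMonoid E]
  [NormedSpace ℝ E] [IsOrderedModule ℝ E] [CompleteSpace E]
  [NormedAddCommGroup F] [Lattice F] [HasSolidNorm F] [IsOrderedAddMonoid F]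
  [NormedSpace ℝ F] [IsOrderedModule ℝ F] [CompleteSpace F]

theorem Complexification.abs_re_le_modulus (z : Complexification E) : |z.re| ≤ z.modulus := by
  refine abs_le'.2 ⟨?_, ?_⟩
  · simpa using z.isLUB_modulus.1 ⟨0, rfl⟩
  · simpa using z.isLUB_modulus.1 ⟨Real.pi, rfl⟩

theorem Complexification.modulus_nonneg (z : Complexification E) : 0 ≤ z.modulus :=
  (abs_nonneg z.re).trans z.abs_re_le_modulus

theorem Complexification.modulus_ofReal (x : E) : (ofReal x).modulus = |x| := by
  refine le_antisymm ((ofReal x).isLUB_modulus.2 ?_) (ofReal x).abs_re_le_modulus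
  rintro _ ⟨t, rfl⟩
  have hx : Real.cos t • x ≤ |Real.cos t| • |x| := by
    rcases le_total 0 (Real.cos t) with hc | hc
    · rw [abs_of_nonneg hc]
      exact smul_le_smul_of_nonneg_left (le_abs_self x) hc
    · rw [abs_of_nonpos hc, ← neg_smul_neg]
      exact smul_le_smul_of_nonneg_left (neg_le_abs x) (neg_nonneg.2 hc)
  calc Real.cos t • x + Real.sin t • (0 : E) = Real.cos t • x := by simp
    _ ≤ |Real.cos t| • |x| := hx
    _ ≤ (1 : ℝ) • |x| := smul_le_smul_of_nonneg_right (Real.abs_cos_le_one t) (abs_nonneg x)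
    _ = |x| := one_smul _ _

/-- The complexification of a positive multilinear mapping satisfies
`|A_ℂ (z, …, z)| ≤ A (|z|, …, |z|)`. -/
theorem MultilinearMap.modulus_complexify_le {A : MultilinearMap ℝ (fun _ : Fin m => E) F}
    (hA : ∀ x : Fin m → E, (∀ i, 0 ≤ x i) → 0 ≤ A x) (z : Complexification E) :
    (A.complexify fun _ => z).modulus ≤ A fun _ => z.modulus := by
  refine (A.complexify fun _ => z).isLUB_modulus.2 ?_
  rintro _ ⟨t, rfl⟩
  have hlim : Tendsto (fun n : ℕ => ((Real.cos (Real.pi / 2 ^ (n + 2)))⁻¹) ^ m •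
      A fun _ => z.modulus) atTop (𝓝 ((1 : ℝ) • A fun _ => z.modulus)) := by
    have h0 : Tendsto (fun n : ℕ => Real.pi / 2 ^ (n + 2)) atTop (𝓝 0) :=
      tendsto_const_nhds.div_atTop ((tendsto_pow_atTop_atTop_of_one_lt (by norm_num)).comp
        (tendsto_add_atTop_nat 2))
    have h1 := ((Real.continuous_cos.tendsto 0).comp h0).inv₀ (by simp)
    have h2 := (h1.pow m).smul_const (A fun _ => z.modulus)
    simpa only [Real.cos_zero, inv_one, one_pow, Function.comp_apply] using h2
  rw [one_smul] at hlim
  exact ge_of_tendsto' hlim fun n => rotation_complexify_le_smul hA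
    (fun t => z.isLUB_modulus.1 ⟨t, rfl⟩) n t

namespace HomPoly

theorem IsPositive.polar_nonneg {P : HomPoly ℝ m E F} (hP : P.IsPositive) (x : Fin m → E)
    (hx : ∀ i, 0 ≤ x i) : 0 ≤ P.polar x := by
  obtain ⟨A, hA, h⟩ := hP
  rw [P.isGeneratedBy_polar.unique hA]
  exact h x hx

theorem norm_complexify_ofReal (P : HomPoly ℝ m E F) (x : E) :
    ‖P.complexify (Complexification.ofReal x)‖ = ‖P x‖ := by
  rw [complexify_ofReal, Complexification.norm_def, Complexification.modulus_ofReal, norm_abs_eq_norm]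

theorem IsPositive.norm_complexify_le {P : HomPoly ℝ m E F} (hP : P.IsPositive)
    (z : Complexification E) : ‖P.complexify z‖ ≤ ‖P z.modulus‖ := by
  rw [Complexification.norm_def]
  refine norm_le_norm_of_abs_le_abs ?_
  rw [abs_of_nonneg (Complexification.modulus_nonneg _)]
  refine le_trans ?_ (le_abs_self _)
  rw [P.isGeneratedBy_polar.2]
  exact MultilinearMap.modulus_complexify_le hP.polar_nonneg z

theorem IsPositive.norm_le_norm_abs {P : HomPoly ℝ m E F} (hP : P.IsPositive) (x : E) :
    ‖P x‖ ≤ ‖P |x|‖ := by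
  rw [← norm_complexify_ofReal, ← Complexification.modulus_ofReal]
  exact hP.norm_complexify_le _

/-- Positive homogeneous polynomials are bounded on the unit ball. -/
theorem IsPositive.boundedOnUnitBall {P : HomPoly ℝ m E F} (hP : P.IsPositive) :
    BoundedOnUnitBall (P : E → F) := by
  by_contra hb
  -- The factor `(2 ^ n) ^ m` offsets the homogeneity of `P` at `2⁻ⁿ • x n`. With `y` the sum of
  -- these vectors, monotonicity would make `‖P y‖` exceed every `n`.
  have hex : ∀ n : ℕ, ∃ x : E, 0 ≤ x ∧ ‖x‖ ≤ 1 ∧ (2 ^ n) ^ m * (n : ℝ) < ‖P x‖ := by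
    intro n
    by_contra! h
    refine hb ⟨(2 ^ n) ^ m * n, ?_⟩
    rintro _ ⟨x, hx, rfl⟩
    exact (hP.norm_le_norm_abs x).trans (h |x| (abs_nonneg x) (by rwa [norm_abs_eq_norm]))
  choose x hx0 hx1 hx using hex
  have hsum : Summable fun n => ((1 / 2 : ℝ) ^ n) • x n := by
    refine Summable.of_norm_bounded summable_geometric_two fun n => ?_
    rw [norm_smul, Real.norm_of_nonneg (by positivity)]
    exact mul_le_of_le_one_right (by positivity) (hx1 n)
  set y := ∑' n, ((1 / 2 : ℝ) ^ n) • x n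
  obtain ⟨n, hn⟩ := exists_nat_gt ‖P y‖
  have hle : ((1 / 2 : ℝ) ^ n) • x n ≤ y :=
    hsum.le_tsum n fun j _ => smul_nonneg (by positivity) (hx0 j)
  have hx' : 0 ≤ ((1 / 2 : ℝ) ^ n) • x n := smul_nonneg (by positivity) (hx0 n)
  have hP1 : P (((1 / 2 : ℝ) ^ n) • x n) = (((1 / 2 : ℝ) ^ n) ^ m) • P (x n) := by
    rw [P.isGeneratedBy_polar.2, P.isGeneratedBy_polar.2,
      P.polar.map_smul_univ (fun _ => (1 / 2 : ℝ) ^ n) fun _ => x n]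
    simp only [Finset.prod_const, Finset.card_univ, Fintype.card_fin]
  have hP2 : ‖P (((1 / 2 : ℝ) ^ n) • x n)‖ ≤ ‖P y‖ := by
    have h0 : 0 ≤ P (((1 / 2 : ℝ) ^ n) • x n) := by
      rw [P.isGeneratedBy_polar.2]
      exact hP.polar_nonneg _ fun _ => hx'
    have h1 : P (((1 / 2 : ℝ) ^ n) • x n) ≤ P y := by
      rw [P.isGeneratedBy_polar.2, P.isGeneratedBy_polar.2]
      exact P.polar.mono_of_nonneg hP.polar_nonneg (fun _ => hx') fun _ => hle
    refine norm_le_norm_of_abs_le_abs ?_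
    rwa [abs_of_nonneg h0, abs_of_nonneg (h0.trans h1)]
  rw [hP1, norm_smul, Real.norm_of_nonneg (by positivity)] at hP2
  have h3 : (n : ℝ) ≤ ((1 / 2 : ℝ) ^ n) ^ m * ‖P (x n)‖ := by
    have := mul_le_mul_of_nonneg_left (hx n).le (show 0 ≤ ((1 / 2 : ℝ) ^ n) ^ m by positivity)
    rwa [← mul_assoc, ← mul_pow, ← mul_pow, one_div_mul_cancel (by norm_num), one_pow, one_pow,
      one_mul] at this
  linarith

theorem IsPositive.boundedOnUnitBall_complexify {P : HomPoly ℝ m E F} (hP : P.IsPositive) :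
    BoundedOnUnitBall (P.complexify : Complexification E → Complexification F) := by
  obtain ⟨M, hM⟩ := hP.boundedOnUnitBall
  refine ⟨M, ?_⟩
  rintro _ ⟨z, hz, rfl⟩
  exact (hP.norm_complexify_le z).trans (hM ⟨z.modulus, hz, rfl⟩)

/-- Both `z ↦ |z|` and the embedding of `E` preserve the norm: the former gives `≤`, the latter `≥`.
-/
theorem IsPositive.supNorm_complexify {P : HomPoly ℝ m E F} (hP : P.IsPositive) :
    supNorm (P.complexify : Complexification E → Complexification F) = supNorm (P : E → F) := by
  refine le_antisymm (csSup_le ⟨_, 0, ?_, rfl⟩ ?_) (csSup_le ⟨_, 0, by simp, rfl⟩ ?_)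
  · have : ‖(Complexification.ofReal (0 : E))‖ ≤ 1 := by
      rw [Complexification.norm_def, Complexification.modulus_ofReal, norm_abs_eq_norm]
      simp
    exact this
  · rintro _ ⟨z, hz, rfl⟩
    exact (hP.norm_complexify_le z).trans (le_csSup hP.boundedOnUnitBall ⟨z.modulus, hz, rfl⟩)
  · rintro _ ⟨x, hx, rfl⟩
    refine le_csSup hP.boundedOnUnitBall_complexify
      ⟨Complexification.ofReal x, ?_, norm_complexify_ofReal P x⟩
    change ‖Complexification.ofReal x‖ ≤ 1
    rw [Complexification.norm_def, Complexification.modulus_ofReal, norm_abs_eq_norm]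
    exact hx

end HomPoly

end Norms

/-! ### Moduli of regular polynomials -/

namespace HomPoly

section Order

variable {m : ℕ} {E F : Type*}
  [AddCommGroup E] [Lattice E] [IsOrderedAddMonoid E] [Module ℝ E]
  [AddCommGroup F] [Lattice F] [IsOrderedAddMonoid F] [Module ℝ F] [IsOrderedModule ℝ F]

theorem IsPositive.zero : (0 : HomPoly ℝ m E F).IsPositive :=
  ⟨0, ⟨fun _ _ => rfl, fun _ => rfl⟩, fun _ _ => le_rfl⟩

theorem IsPositive.add {P Q : HomPoly ℝ m E F} (hP : P.IsPositive) (hQ : Q.IsPositive) :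
    (P + Q).IsPositive := by
  obtain ⟨A, hA, hA0⟩ := hP
  obtain ⟨B, hB, hB0⟩ := hQ
  exact ⟨A + B, hA.add hB, fun x hx => add_nonneg (hA0 x hx) (hB0 x hx)⟩

theorem IsPositive.smul {P : HomPoly ℝ m E F} (hP : P.IsPositive) {c : ℝ} (hc : 0 ≤ c) :
    (c • P).IsPositive := by
  obtain ⟨A, hA, hA0⟩ := hP
  exact ⟨c • A, hA.smul c, fun x hx => smul_nonneg hc (hA0 x hx)⟩

theorem IsPositive.isRegular {P : HomPoly ℝ m E F} (hP : P.IsPositive) : P.IsRegular :=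
  ⟨P, 0, hP, .zero, by simp⟩

/-- The order on the space of homogeneous polynomials is antisymmetric. -/
theorem eq_of_isPositive_sub {P Q : HomPoly ℝ m E F} (h₁ : (P - Q).IsPositive)
    (h₂ : (Q - P).IsPositive) : P = Q := by
  obtain ⟨A, hA, hA0⟩ := h₁
  obtain ⟨B, hB, hB0⟩ := h₂
  have hAB : A + B = 0 := by
    refine (hA.add hB).unique ⟨fun _ _ => rfl, fun x => ?_⟩
    simp
  have hA' : A = 0 := MultilinearMap.ext_of_nonneg fun x hx => by
    refine le_antisymm ?_ (hA0 x hx)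
    have : A x = -B x := eq_neg_of_add_eq_zero_left (DFunLike.congr_fun hAB x)
    rw [this]
    exact neg_nonpos.2 (hB0 x hx)
  subst hA'
  ext x
  have := hA.2 x
  exact sub_eq_zero.1 this

theorem IsRegularSup.unique {S : Set (HomPoly ℝ m E F)} {R R' : HomPoly ℝ m E F}
    (h : IsRegularSup S R) (h' : IsRegularSup S R') : R = R' :=
  eq_of_isPositive_sub (h'.2.2 R h.1 h.2.1) (h.2.2 R' h'.1 h'.2.1)

/-- `R` is the mean of the positive polynomials `R - P` and `R + P`. -/
theorem IsModulus.isPositive {P R : HomPoly ℝ m E F} (h : P.IsModulus R) : R.IsPositive := by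
  have h1 := h.2.1 P (by simp)
  have h2 := h.2.1 (-P) (by simp)
  have := (h1.add h2).smul (show (0 : ℝ) ≤ 1 / 2 by norm_num)
  convert this using 1
  module

theorem IsRegular.exists_isModulus [IsOrderedModule ℝ E] (hF : DedekindComplete F)
    {P : HomPoly ℝ m E F} (hP : P.IsRegular) : ∃ R, P.IsModulus R := by
  obtain ⟨P₁, P₂, ⟨A₁, hA₁, h₁⟩, ⟨A₂, hA₂, h₂⟩, rfl⟩ := hP
  have hA := hA₁.sub hA₂
  -- On the cone, `A₁ + A₂` dominates `± (A₁ - A₂)`.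
  obtain ⟨R, hR₁, hR₂, hR₃⟩ := exists_multilinear_modulus hF (A₁ - A₂) (A₁ + A₂)
    (fun x hx => by
      have := h₂ x hx
      rw [sub_apply, add_apply]
      exact (sub_le_self _ this).trans (le_add_of_nonneg_right this))
    (fun x hx => by
      have := h₁ x hx
      rw [sub_apply, add_apply, neg_sub]
      exact (sub_le_self _ this).trans (le_add_of_nonneg_left this))
  have hsymm := symm_of_isLeast_modulus hA.1 hR₁ hR₂ hR₃
  let Q : HomPoly ℝ m E F := ⟨fun x => R fun _ => x, R, hsymm, fun _ => rfl⟩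
  have hQ : IsGeneratedBy Q R := ⟨hsymm, fun _ => rfl⟩
  have hQ₁ : (Q - (P₁ - P₂)).IsPositive :=
    ⟨_, hQ.sub hA, fun x hx => sub_nonneg.2 (hR₁ x hx)⟩
  have hQ₂ : (Q - -(P₁ - P₂)).IsPositive := by
    rw [sub_neg_eq_add]
    exact ⟨_, hQ.add hA, fun x hx => neg_le_iff_add_nonneg.1 (hR₂ x hx)⟩
  have hpos : Q.IsPositive := by
    refine ⟨R, hQ, fun x hx => ?_⟩
    have h2 : 0 ≤ (2 : ℝ) • R x := by
      rw [two_smul]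
      exact le_of_eq_of_le (by simp) (add_le_add (hR₁ x hx) (hR₂ x hx))
    have := smul_nonneg (show (0 : ℝ) ≤ 2⁻¹ by norm_num) h2
    rwa [inv_smul_smul₀ two_ne_zero] at this
  refine ⟨Q, hpos.isRegular, ?_, fun T _ hT => ?_⟩
  · rintro _ (rfl | rfl)
    exacts [hQ₁, hQ₂]
  · obtain ⟨B₁, hB₁, hB₁0⟩ := hT _ (Or.inl rfl)
    obtain ⟨B₂, hB₂, hB₂0⟩ := hT _ (Or.inr rfl)
    -- The two inequalities yield two generators of `T`; uniqueness identifies them, so one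
    -- multilinear mapping dominates both signs.
    have hT₁ : IsGeneratedBy T (B₁ + (A₁ - A₂)) := by
      simpa using hB₁.add hA
    have hT₂ : IsGeneratedBy T (B₂ - (A₁ - A₂)) := by
      have h := hB₂.sub hA
      rwa [sub_neg_eq_add, add_sub_cancel_right] at h
    refine ⟨_, hT₁.sub hQ, fun x hx => sub_nonneg.2 (hR₃ _ (fun x hx => ?_) (fun x hx => ?_) x hx)⟩
    · rw [add_apply]
      exact le_add_of_nonneg_left (hB₁0 x hx)
    · rw [hT₁.unique hT₂, sub_apply B₂, sub_eq_add_neg (B₂ x)]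
      exact le_add_of_nonneg_left (hB₂0 x hx)

theorem IsRegular.isModulus_modulus [IsOrderedModule ℝ E] (hF : DedekindComplete F)
    {P : HomPoly ℝ m E F} (hP : P.IsRegular) : P.IsModulus P.modulus := by
  have h := hP.exists_isModulus hF
  rw [modulus, dif_pos h]
  exact Classical.choose_spec h

theorem rePart_complexify (P : HomPoly ℝ m E F) : P.complexify.rePart = P :=
  Subtype.ext (funext fun x => congrArg Complexification.re (P.complexify_ofReal x))

theorem imPart_complexify (P : HomPoly ℝ m E F) : P.complexify.imPart = 0 :=
  Subtype.ext (funext fun x => congrArg Complexification.im (P.complexify_ofReal x))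

theorem IsRegular.isRegularC_complexify {P : HomPoly ℝ m E F} (hP : P.IsRegular) :
    P.complexify.IsRegularC := by
  rw [IsRegularC, rePart_complexify, imPart_complexify]
  exact ⟨hP, IsPositive.zero.isRegular⟩

theorem isModulusC_complexify_iff {P R : HomPoly ℝ m E F} :
    P.complexify.IsModulusC R ↔ P.IsModulus R := by
  have hub : ∀ Q : HomPoly ℝ m E F,
      (∀ T ∈ Set.range fun t : ℝ => Real.cos t • P + Real.sin t • (0 : HomPoly ℝ m E F),
        (Q - T).IsPositive) ↔ ∀ T ∈ ({P, -P} : Set (HomPoly ℝ m E F)), (Q - T).IsPositive := by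
    intro Q
    constructor
    · rintro h _ (rfl | rfl)
      · exact h _ ⟨0, by simp⟩
      · exact h _ ⟨Real.pi, by
          change Real.cos Real.pi • P + Real.sin Real.pi • (0 : HomPoly ℝ m E F) = -P
          rw [Real.cos_pi]
          module⟩
    · rintro h _ ⟨t, rfl⟩
      -- The weights `(1 ± cos t) / 2` sum to one and write `cos t • P` as a convex combination of
      -- `P` and `-P`.
      have h1 := (h P (Or.inl rfl)).smul (show 0 ≤ (1 + Real.cos t) / 2 by
        linarith [Real.neg_one_le_cos t])
      have h2 := (h (-P) (Or.inr rfl)).smul (show 0 ≤ (1 - Real.cos t) / 2 by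
        linarith [Real.cos_le_one t])
      convert h1.add h2 using 1
      module
  simp only [IsModulusC, IsModulus, IsRegularSup, rePart_complexify, imPart_complexify, hub]

/-- Both sides are chosen suprema with the same defining property, so uniqueness identifies them. -/
theorem IsRegular.modulusC_complexify [IsOrderedModule ℝ E] (hF : DedekindComplete F)
    {P : HomPoly ℝ m E F} (hP : P.IsRegular) : P.complexify.modulusC = P.modulus := by
  have h : ∃ R, P.complexify.IsModulusC R :=
    ⟨P.modulus, isModulusC_complexify_iff.2 (hP.isModulus_modulus hF)⟩
  rw [modulusC, dif_pos h]
  exact IsRegularSup.unique (isModulusC_complexify_iff.1 (Classical.choose_spec h))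
    (hP.isModulus_modulus hF)

end Order

end HomPoly

theorem theorem2p6 {E F : Type*}
    [NormedAddCommGroup E] [Lattice E] [HasSolidNorm E] [IsOrderedAddMonoid E]
    [NormedSpace ℝ E] [IsOrderedModule ℝ E] [CompleteSpace E]
    [NormedAddCommGroup F] [Lattice F] [HasSolidNorm F] [IsOrderedAddMonoid F]
    [NormedSpace ℝ F] [IsOrderedModule ℝ F] [CompleteSpace F]
    (hF : DedekindComplete F) (m : ℕ) (P : HomPoly ℝ m E F) (hP : P.IsRegular) :
    -- the moduli exist, and the regular norms are finite
    (P.IsModulus P.modulus ∧ P.complexify.IsRegularC ∧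
      P.complexify.IsModulusC P.complexify.modulusC ∧
      BoundedOnUnitBall (P.modulus : E → F) ∧
      BoundedOnUnitBall (P.complexify.modulusC.complexify :
        Complexification E → Complexification F)) ∧
    -- `|P_ℂ| = |P|_ℂ`
    P.complexify.modulusC.complexify = P.modulus.complexify ∧
    -- `‖P_ℂ‖_r = ‖P‖_r`
    P.complexify.regularNormC = P.regularNorm := by

  have hmod := hP.isModulus_modulus hF
  have hpos := hmod.isPositive
  rw [HomPoly.regularNormC, HomPoly.regularNorm, hP.modulusC_complexify hF]
  exact ⟨⟨hmod, hP.isRegularC_complexify, HomPoly.isModulusC_complexify_iff.2 hmod,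
    hpos.boundedOnUnitBall, hpos.boundedOnUnitBall_complexify⟩, rfl, hpos.supNorm_complexify⟩
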